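/- Let $X$ be a complex Hilbert space. Let $W^{1,2}([-1,0],X)$ be the space of absolutely continuous $f:[-1,0]\to X$ of the form $f(\sigma)=x+\int_0^\sigma f'(s)\,ds$ with $x\in X$ and $f'\in L^2([-1,0],X)$, with its usual norm, and let $\Phi:W^{1,2}([-1,0],X)\to X$ be a bounded linear operator. For a linear operator $(B,D(B))$ on $X$ consider on $\mathcal E:=X\times L^2([-1,0],X)$ the operator $$\mathcal A\binom{x}{f}=\binom{Bx+\Phi f}{f'},\qquad D(\mathcal A)=\Big\{\tbinom{x}{f}\in D(B)\times W^{1,2}([-1,0],X)\;:\;f(0)=x\Big\},$$ associated with the delay equation $u'(t)=Bu(t)+\Phi u_t$, where $u_t(\sigma)=u(t+\sigma)$. Let $A_0f=f'$ with $D(A_0)=\{f\in W^{1,2}([-1,0],X): f(0)=0\}$ be the generator of the nilpotent left shift semigroup on $L^2([-1,0],X)$, and for $\lambda\in\mathbb C$ let $\Phi_\lambda\in\mathcal L(X)$ be given by $\Phi_\lambda x:=\Phi(e^{\lambda\,\cdot}x)$. We call $\Phi$ admissible if (a) $\mathcal A$ generates a strongly continuous semigroup on $\mathcal E$ for every generator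 $(B,D(B))$ of a strongly continuous semigroup on $X$, and (b) for every $\omega\in\mathbb R$ the function $\lambda\mapsto\Phi R(\lambda,A_0)\in\mathcal L(L^2([-1,0],X),X)$ is bounded and analytic on $\{\lambda\in\mathbb C:\operatorname{Re}\lambda>\omega\}$. For the generator $G$ of a strongly continuous semigroup $(T(t))_{t\ge0}$ write $R(\lambda,G)=(\lambda-G)^{-1}$ and $\omega_0(G)=\inf\{w\in\mathbb R:\exists M\ \forall t\ge 0\ \|T(t)\|\le Me^{wt}\}\in[-\infty,\infty)$. **Theorem.** Assume that $\Phi$ is admissible and that $(B,D(B))$ generates a strongly continuous semigroup on $X$ with $\omega_0(B)<0$. Put $$a_n:=\sup_{\omega\in\mathbb R}\big\|(\Phi_{i\omega}R(i\omega,B))^n\big\|\qquad(n=0,1,2,\dots).$$ If all $a_n$ are finite and $\sum_{n=0}^\infty a_n<\infty$, then $\omega_0(\mathcal A)<0$, i.e. the strongly continuous semigroup generated by $\mathcal A$ on $\mathcal E$ is uniformly exponentially stable. -/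

import Mathlib

open MeasureTheory Set Filter Topology
open scoped ENNReal NNReal

noncomputable section

namespace DelayEq

/-! ### Strongly continuous semigroups, generators, growth bounds, resolvents -/

section Semigroups

variable {E : Type*} [NormedAddCommGroup E] [NormedSpace ℂ E]

/-- Strongly continuous one-parameter semigroups of bounded operators on `E`. -/
structure C0Semigroup (E : Type*) [NormedAddCommGroup E] [NormedSpace ℂ E] where
  op : ℝ≥0 → E →L[ℂ] E
  op_zero : op 0 = ContinuousLinearMap.id ℂ E
  op_add : ∀ s t, op (s + t) = (op s).comp (op t)
  strongly_continuous : ∀ x, Continuous fun t => op t x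

/-- `y` is the right derivative at `0` of the orbit of `x`. -/
def C0Semigroup.HasGenerator (T : C0Semigroup E) (x y : E) : Prop :=
  Tendsto (fun t : ℝ≥0 => ((t : ℝ) : ℂ)⁻¹ • (T.op t x - x)) (𝓝[>] 0) (𝓝 y)

theorem C0Semigroup.HasGenerator.unique {T : C0Semigroup E} {x y z : E}
    (h : T.HasGenerator x y) (h' : T.HasGenerator x z) : y = z :=
  tendsto_nhds_unique h h'

theorem C0Semigroup.HasGenerator.add {T : C0Semigroup E} {x y x' y' : E}
    (h : T.HasGenerator x y) (h' : T.HasGenerator x' y') :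
    T.HasGenerator (x + x') (y + y') := by
  refine (Tendsto.add h h').congr fun t => ?_
  rw [← smul_add, map_add]
  congr 1
  abel

theorem C0Semigroup.HasGenerator.smul {T : C0Semigroup E} {x y : E} (c : ℂ)
    (h : T.HasGenerator x y) : T.HasGenerator (c • x) (c • y) := by
  refine (Tendsto.const_smul h c).congr fun t => ?_
  rw [smul_comm, map_smul, smul_sub]

/-- The (infinitesimal) generator of a strongly continuous semigroup, with its domain. -/
def C0Semigroup.generator (T : C0Semigroup E) : E →ₗ.[ℂ] E where
  domain :=
    { carrier := {x | ∃ y, T.HasGenerator x y}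
      add_mem' := fun ⟨y, hy⟩ ⟨z, hz⟩ => ⟨y + z, hy.add hz⟩
      zero_mem' := ⟨0, by simp [C0Semigroup.HasGenerator]⟩
      smul_mem' := fun c _ ⟨y, hy⟩ => ⟨c • y, hy.smul c⟩ }
  toFun :=
    { toFun := fun x => Classical.choose x.2
      map_add' := fun x y => (Classical.choose_spec (x + y).2).unique
        ((Classical.choose_spec x.2).add (Classical.choose_spec y.2))
      map_smul' := fun c x => (Classical.choose_spec (c • x).2).unique
        ((Classical.choose_spec x.2).smul c) }

/-- `A` (with its domain) generates a strongly continuous semigroup. -/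
def IsGenerator (A : E →ₗ.[ℂ] E) : Prop :=
  ∃ T : C0Semigroup E, T.generator = A

/-- The growth bound `inf {w ∈ ℝ | ∃ M, ∀ t ≥ 0, ‖T(t)‖ ≤ M e^{wt}}`, in `[-∞, ∞]`. -/
def C0Semigroup.growthBound (T : C0Semigroup E) : EReal :=
  ⨅ (w : ℝ) (_ : ∃ M : ℝ, ∀ t : ℝ≥0, ‖T.op t‖ ≤ M * Real.exp (w * t)), (w : EReal)

/-- `R` is a bounded two-sided inverse of `z - A : D(A) → E`. -/
def IsResolventAt (A : E →ₗ.[ℂ] E) (z : ℂ) (R : E →L[ℂ] E) : Prop :=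
  (∀ x, ∃ h : R x ∈ A.domain, z • R x - A ⟨R x, h⟩ = x) ∧
    ∀ y : A.domain, R (z • (y : E) - A y) = y

/-- The resolvent set `ρ(A)`. -/
def opResolventSet (A : E →ₗ.[ℂ] E) : Set ℂ :=
  {z | ∃ R, IsResolventAt A z R}

open Classical in
/-- The resolvent `R(z, A) = (z - A)⁻¹` for `z ∈ ρ(A)` (and `0` outside `ρ(A)`). -/
def opResolvent (A : E →ₗ.[ℂ] E) (z : ℂ) : E →L[ℂ] E :=
  if h : z ∈ opResolventSet A then Classical.choose h else 0

theorem opResolvent_spec {A : E →ₗ.[ℂ] E} {z : ℂ} (h : z ∈ opResolventSet A) :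
    IsResolventAt A z (opResolvent A z) := by
  rw [opResolvent, dif_pos h]
  exact Classical.choose_spec h

end Semigroups

/-! ### The history space `L²([-1,0], X)` and the Sobolev space `W^{1,2}([-1,0], X)` -/

section Sobolev

/-- Lebesgue measure on `[-1,0]`. -/
abbrev histMeasure : Measure ℝ := volume.restrict (Icc (-1) 0)

/-- `L²([-1,0], X)`. -/
abbrev L2Hist (X : Type*) [NormedAddCommGroup X] : Type _ := Lp X 2 histMeasure

variable {X : Type*} [NormedAddCommGroup X] [NormedSpace ℂ X]

/-- `f` has the absolutely continuous representative `σ ↦ x + ∫₀^σ g(s) ds` on `[-1,0]`;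
so its value at `0` is `x` and its derivative is `g`. -/
def IsPrimitive (x : X) (f g : L2Hist X) : Prop :=
  ∀ᵐ σ ∂histMeasure, f σ = x + ∫ s in (0 : ℝ)..σ, g s

theorem L2Hist.integrable {X : Type*} [NormedAddCommGroup X] (g : L2Hist X) : Integrable g histMeasure :=
  (Lp.memLp g).integrable (by norm_num)

theorem L2Hist.intervalIntegrable {X : Type*} [NormedAddCommGroup X] (g : L2Hist X) {σ : ℝ} (hσ : σ ∈ Icc (-1 : ℝ) 0) :
    IntervalIntegrable g volume 0 σ := by
  rw [intervalIntegrable_iff]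
  refine IntegrableOn.mono_set (t := Icc (-1) 0) g.integrable ?_
  rw [uIoc_of_ge hσ.2]
  exact fun s hs => ⟨hσ.1.trans hs.1.le, hs.2⟩

theorem intervalIntegral_congr_hist {g g' : ℝ → X} (h : g =ᵐ[histMeasure] g') {σ : ℝ}
    (hσ : σ ∈ Icc (-1 : ℝ) 0) : ∫ s in (0 : ℝ)..σ, g s = ∫ s in (0 : ℝ)..σ, g' s := by
  refine intervalIntegral.integral_congr_ae_restrict ?_
  refine ae_restrict_of_ae_restrict_of_subset ?_ h
  rw [uIoc_of_ge hσ.2]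
  exact fun s hs => ⟨hσ.1.trans hs.1.le, hs.2⟩

theorem IsPrimitive.add {x x' : X} {f f' g g' : L2Hist X} (h : IsPrimitive x f g)
    (h' : IsPrimitive x' f' g') : IsPrimitive (x + x') (f + f') (g + g') := by
  filter_upwards [h, h', Lp.coeFn_add f f', ae_restrict_mem measurableSet_Icc]
    with σ h1 h2 h3 hσ
  rw [h3, Pi.add_apply, h1, h2, intervalIntegral_congr_hist (Lp.coeFn_add g g') hσ]
  simp only [Pi.add_apply]
  rw [intervalIntegral.integral_add (g.intervalIntegrable hσ) (g'.intervalIntegrable hσ)]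
  abel

theorem IsPrimitive.smul {x : X} {f g : L2Hist X} (c : ℂ) (h : IsPrimitive x f g) :
    IsPrimitive (c • x) (c • f) (c • g) := by
  filter_upwards [h, Lp.coeFn_smul c f, ae_restrict_mem measurableSet_Icc] with σ h1 h3 hσ
  rw [h3, Pi.smul_apply, h1, intervalIntegral_congr_hist (Lp.coeFn_smul c g) hσ]
  simp only [Pi.smul_apply]
  rw [intervalIntegral.integral_smul, smul_add]

theorem IsPrimitive.zero : IsPrimitive (0 : X) 0 0 := by
  simpa using IsPrimitive.smul (0 : ℂ) (x := (0 : X)) (f := 0) (g := 0) (by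
    filter_upwards [Lp.coeFn_zero X 2 histMeasure, ae_restrict_mem measurableSet_Icc] with σ h hσ
    rw [h, intervalIntegral_congr_hist (Lp.coeFn_zero X 2 histMeasure) hσ]
    simp)

theorem IsPrimitive.eq_zero [CompleteSpace X] {x : X} {g : L2Hist X} (h : IsPrimitive x 0 g) :
    x = 0 ∧ g = 0 := by
  have hint : IntervalIntegrable g volume 0 (-1) :=
    g.intervalIntegrable ⟨le_rfl, by norm_num⟩
  have hcont : ContinuousOn (fun σ => x + ∫ s in (0 : ℝ)..σ, g s) (Icc (-1) 0) := by
    have := intervalIntegral.continuousOn_primitive_interval' hint (left_mem_uIcc)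
    rw [uIcc_of_ge (by norm_num)] at this
    exact continuousOn_const.add this
  have hzero : EqOn (fun σ => x + ∫ s in (0 : ℝ)..σ, g s) (fun _ => 0) (Icc (-1) 0) := by
    refine Measure.eqOn_Icc_of_ae_eq volume (by norm_num) ?_ hcont continuousOn_const
    filter_upwards [h, Lp.coeFn_zero X 2 histMeasure] with σ h1 h2
    rw [← h1, h2, Pi.zero_apply]
  have hx : x = 0 := by simpa using hzero (x := 0) ⟨by norm_num, le_rfl⟩
  refine ⟨hx, ?_⟩
  rw [Lp.eq_zero_iff_ae_eq_zero]
  have hd := hint.ae_hasDerivAt_integral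
  have hne : ∀ᵐ σ ∂histMeasure, σ ∈ Ioo (-1 : ℝ) 0 := by
    rw [histMeasure, ← restrict_Ioo_eq_restrict_Icc]
    exact ae_restrict_mem measurableSet_Ioo
  filter_upwards [hne, ae_restrict_of_ae hd] with σ hσ h1
  have hσ' : σ ∈ uIcc (0 : ℝ) (-1) := by
    rw [uIcc_of_ge (by norm_num)]; exact Ioo_subset_Icc_self hσ
  have h2 := h1 hσ' 0 left_mem_uIcc
  have h3 : (fun u => ∫ s in (0 : ℝ)..u, g s) =ᶠ[𝓝 σ] fun _ => 0 := by
    filter_upwards [Icc_mem_nhds hσ.1 hσ.2] with u hu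
    simpa [hx] using hzero hu
  exact h2.unique ((hasDerivAt_const σ (0 : X)).congr_of_eventuallyEq h3)

theorem IsPrimitive.unique [CompleteSpace X] {x x' : X} {f g g' : L2Hist X}
    (h : IsPrimitive x f g) (h' : IsPrimitive x' f g') : x = x' ∧ g = g' := by
  have h1 := h.add (h'.smul (-1))
  have h2 : IsPrimitive (x - x') 0 (g - g') := by
    simpa [sub_eq_add_neg] using h1
  exact ⟨sub_eq_zero.1 h2.eq_zero.1, sub_eq_zero.1 h2.eq_zero.2⟩

/-- `W^{1,2}([-1,0], X)`. Its elements are the pairs `(f, f')` where `f ∈ L²` is absolutely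
continuous with derivative `f' ∈ L²` (`f'` is determined by `f`). The inherited norm is the usual
one, `(‖f‖² + ‖f'‖²)^{1/2}`. -/
def sobolev (X : Type*) [NormedAddCommGroup X] [NormedSpace ℂ X] :
    Submodule ℂ (WithLp 2 (L2Hist X × L2Hist X)) where
  carrier := {p | ∃ x, IsPrimitive x p.fst p.snd}
  add_mem' := fun ⟨x, hx⟩ ⟨y, hy⟩ => ⟨x + y, hx.add hy⟩
  zero_mem' := ⟨0, IsPrimitive.zero⟩
  smul_mem' := fun c _ ⟨x, hx⟩ => ⟨c • x, hx.smul c⟩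

/-- The Sobolev space `W^{1,2}([-1,0], X)` as a normed space. -/
abbrev W12 (X : Type*) [NormedAddCommGroup X] [NormedSpace ℂ X] : Type _ := sobolev X

/-- The operator `f ↦ R f` into `W^{1,2}([-1,0], X)`, where `(R f)' = D f`. -/
def W12.lift {E : Type*} [NormedAddCommGroup E] [NormedSpace ℂ E] (R D : E →L[ℂ] L2Hist X)
    (h : ∀ f, WithLp.toLp 2 (R f, D f) ∈ sobolev X) : E →L[ℂ] W12 X :=
  ((WithLp.prodContinuousLinearEquiv 2 ℂ (L2Hist X) (L2Hist X)).symm.toContinuousLinearMap ∘L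
    R.prod D).codRestrict (sobolev X) h

/-- The inclusion `W^{1,2}([-1,0], X) → L²([-1,0], X)`. -/
def W12.toL2 : W12 X →ₗ[ℂ] L2Hist X where
  toFun w := w.1.fst
  map_add' _ _ := rfl
  map_smul' _ _ := rfl

/-- The derivative `d/dσ : W^{1,2}([-1,0], X) → L²([-1,0], X)`. -/
def W12.deriv : W12 X →ₗ[ℂ] L2Hist X where
  toFun w := w.1.snd
  map_add' _ _ := rfl
  map_smul' _ _ := rfl

/-- The value `f(0)` of (the continuous representative of) `f ∈ W^{1,2}([-1,0], X)`. -/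
def W12.evalZero [CompleteSpace X] : W12 X →ₗ[ℂ] X where
  toFun w := Classical.choose w.2
  map_add' v w := ((Classical.choose_spec (v + w).2).unique
    ((Classical.choose_spec v.2).add (Classical.choose_spec w.2))).1
  map_smul' c w := ((Classical.choose_spec (c • w).2).unique
    ((Classical.choose_spec w.2).smul c)).1

theorem W12.toL2_injective [CompleteSpace X] : Function.Injective (W12.toL2 (X := X)) := by
  rintro ⟨v, x, hv⟩ ⟨w, y, hw⟩ h
  have h1 : v.fst = w.fst := h
  rw [h1] at hv
  have h2 := (hv.unique hw).2
  apply Subtype.ext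
  apply (WithLp.equiv 2 _).injective
  exact Prod.ext h1 h2

/-- An `L²` function that lies in `W^{1,2}`, as an element of `W^{1,2}`. -/
def W12.ofL2 [CompleteSpace X] : LinearMap.range (W12.toL2 (X := X)) ≃ₗ[ℂ] W12 X :=
  (LinearEquiv.ofInjective W12.toL2 W12.toL2_injective).symm

end Sobolev

/-! ### The delay equation `u'(t) = B u(t) + Φ u_t` -/

section Delay

variable {X : Type*} [NormedAddCommGroup X] [NormedSpace ℂ X]

/-- The state space `X × L²([-1,0], X)`. -/
abbrev StateSpace (X : Type*) [NormedAddCommGroup X] : Type _ := WithLp 2 (X × L2Hist X)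

/-- The domain `D(𝒜) = {(x, f) ∈ D(B) × W^{1,2} | f(0) = x}`. -/
def delayDomain [CompleteSpace X] (B : X →ₗ.[ℂ] X) : Submodule ℂ (StateSpace X) where
  carrier := {z | z.fst ∈ B.domain ∧
    ∃ w : W12 X, W12.toL2 w = z.snd ∧ W12.evalZero w = z.fst}
  add_mem' := by
    rintro z z' ⟨h1, w, h2, h3⟩ ⟨h1', w', h2', h3'⟩
    exact ⟨add_mem h1 h1', w + w', by rw [map_add, h2, h2']; rfl, by rw [map_add, h3, h3']; rfl⟩
  zero_mem' := ⟨zero_mem _, 0, map_zero _, map_zero _⟩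
  smul_mem' := by
    rintro c z ⟨h1, w, h2, h3⟩
    exact ⟨Submodule.smul_mem _ c h1, c • w, by rw [map_smul, h2]; rfl,
      by rw [map_smul, h3]; rfl⟩

/-- `(x, f) ↦ x` from `D(𝒜)` to `D(B)`. -/
def delayDomain.toDomain [CompleteSpace X] (B : X →ₗ.[ℂ] X) : delayDomain B →ₗ[ℂ] B.domain where
  toFun z := ⟨z.1.fst, z.2.1⟩
  map_add' _ _ := rfl
  map_smul' _ _ := rfl

/-- `(x, f) ↦ f` from `D(𝒜)` to `W^{1,2}`. -/
def delayDomain.toW12 [CompleteSpace X] (B : X →ₗ.[ℂ] X) : delayDomain B →ₗ[ℂ] W12 X :=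
  W12.ofL2.toLinearMap ∘ₗ
    { toFun := fun z => ⟨z.1.snd, z.2.2.imp fun _ h => h.1⟩
      map_add' := fun _ _ => rfl
      map_smul' := fun _ _ => rfl }

/-- The operator `𝒜 (x, f) = (B x + Φ f, f')` with domain
`{(x, f) ∈ D(B) × W^{1,2} | f(0) = x}`. -/
def delayOperator [CompleteSpace X] (B : X →ₗ.[ℂ] X) (Φ : W12 X →L[ℂ] X) :
    StateSpace X →ₗ.[ℂ] StateSpace X where
  domain := delayDomain B
  toFun := (WithLp.linearEquiv 2 ℂ (X × L2Hist X)).symm.toLinearMap ∘ₗ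
    (B.toFun ∘ₗ delayDomain.toDomain B + Φ.toLinearMap ∘ₗ delayDomain.toW12 B).prod
      (W12.deriv ∘ₗ delayDomain.toW12 B)

/-- Sanity check: the action of `𝒜` on a pair `(f(0), f)` with `f ∈ W^{1,2}`, `f(0) ∈ D(B)`. -/
theorem delayOperator_apply [CompleteSpace X] (B : X →ₗ.[ℂ] X) (Φ : W12 X →L[ℂ] X) (w : W12 X)
    (hw : W12.evalZero w ∈ B.domain) :
    delayOperator B Φ
      ⟨WithLp.toLp 2 (W12.evalZero w, W12.toL2 w), hw, w, rfl, rfl⟩ =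
      WithLp.toLp 2 (B ⟨W12.evalZero w, hw⟩ + Φ w, W12.deriv w) := by
  have h : W12.ofL2 ⟨W12.toL2 w, ⟨w, rfl⟩⟩ = w :=
    (LinearEquiv.symm_apply_eq _).2 rfl
  have h1 : WithLp.toLp 2 (B ⟨W12.evalZero w, hw⟩ + Φ (W12.ofL2 ⟨W12.toL2 w, ⟨w, rfl⟩⟩),
      W12.deriv (W12.ofL2 ⟨W12.toL2 w, ⟨w, rfl⟩⟩)) =
      WithLp.toLp 2 (B ⟨W12.evalZero w, hw⟩ + Φ w, W12.deriv w) := by rw [h]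
  exact h1

/-- The operator `A₀ f = f'` on `L²([-1,0], X)` with domain `{f ∈ W^{1,2} | f(0) = 0}`, which is
the generator of the nilpotent left shift semigroup. -/
def shiftGenerator (X : Type*) [NormedAddCommGroup X] [NormedSpace ℂ X] [CompleteSpace X] :
    L2Hist X →ₗ.[ℂ] L2Hist X where
  domain := (LinearMap.ker (W12.evalZero (X := X))).map W12.toL2
  toFun := W12.deriv ∘ₗ W12.ofL2.toLinearMap ∘ₗ Submodule.inclusion (LinearMap.map_le_range)

theorem shiftGenerator_mem [CompleteSpace X] (f : (shiftGenerator X).domain) :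
    (WithLp.toLp 2 ((f : L2Hist X), shiftGenerator X f) : WithLp 2 (L2Hist X × L2Hist X))
      ∈ sobolev X := by
  obtain ⟨f, w, hw, rfl⟩ := f
  have : W12.ofL2 ⟨W12.toL2 w, ⟨w, rfl⟩⟩ = w :=
    (LinearEquiv.symm_apply_eq _).2 rfl
  have h2 : shiftGenerator X ⟨W12.toL2 w, w, hw, rfl⟩ = W12.deriv w :=
    congrArg W12.deriv this
  rw [h2]
  exact w.2

open Classical in
/-- The bounded operator `R(z, A₀)`, regarded as an operator from `L²([-1,0], X)` to
`W^{1,2}([-1,0], X)`; note that `A₀ R(z, A₀) = z R(z, A₀) - 1`. -/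
def shiftResolvent [CompleteSpace X] (z : ℂ) : L2Hist X →L[ℂ] W12 X :=
  if h : z ∈ opResolventSet (shiftGenerator X) then
    W12.lift (opResolvent (shiftGenerator X) z)
      (z • opResolvent (shiftGenerator X) z - ContinuousLinearMap.id ℂ _)
      (fun f => by
        obtain ⟨h1, h2⟩ := (opResolvent_spec h).1 f
        have h3 := shiftGenerator_mem ⟨_, h1⟩
        rw [show shiftGenerator X ⟨_, h1⟩ = z • opResolvent (shiftGenerator X) z f - f from by
          rw [eq_sub_iff_add_eq, ← eq_sub_iff_add_eq', h2]] at h3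
        exact h3)
  else 0

/-- The delay operator `Φ` is admissible: (a) `𝒜` is a generator for every generator `B`, and
(b) `z ↦ Φ R(z, A₀)` is bounded and analytic on every half-plane `Re z > ω`. -/
def Admissible [CompleteSpace X] (Φ : W12 X →L[ℂ] X) : Prop :=
  (∀ B : X →ₗ.[ℂ] X, IsGenerator B → IsGenerator (delayOperator B Φ)) ∧
  ∀ ω : ℝ,
    AnalyticOnNhd ℂ (fun z : ℂ => Φ ∘L shiftResolvent z) {z | ω < z.re} ∧
    ∃ C : ℝ, ∀ z : ℂ, ω < z.re → ‖Φ ∘L shiftResolvent z‖ ≤ C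

/-- The exponential `σ ↦ e^{zσ}` is in `L²([-1,0])`. -/
theorem memLp_exp (z : ℂ) : MemLp (fun σ : ℝ => Complex.exp (z * σ)) 2 histMeasure := by
  refine MemLp.of_bound (by fun_prop) (Real.exp |z.re|) ?_
  filter_upwards [ae_restrict_mem measurableSet_Icc] with σ hσ
  rw [Complex.norm_exp, Real.exp_le_exp]
  have : (z * σ).re = z.re * σ := by simp
  rw [this]
  have h1 : |σ| ≤ 1 := abs_le.2 ⟨hσ.1, hσ.2.trans zero_le_one⟩
  calc z.re * σ ≤ |z.re * σ| := le_abs_self _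
    _ = |z.re| * |σ| := abs_mul _ _
    _ ≤ |z.re| := mul_le_of_le_one_right (abs_nonneg _) h1

/-- The map `x ↦ ε_z ⊗ x = e^{z ·} x` from `X` to `L²([-1,0], X)`. -/
def expL2 (z : ℂ) : X →L[ℂ] L2Hist X :=
  (ContinuousLinearMap.compLpL₂ 2 histMeasure
    (ContinuousLinearMap.lsmul ℂ ℂ (E := X)).flip).flip ((memLp_exp z).toLp _)

theorem expL2_coeFn (z : ℂ) (x : X) :
    expL2 z x =ᵐ[histMeasure] fun σ : ℝ => Complex.exp (z * σ) • x := by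
  have h1 := ContinuousLinearMap.coeFn_compLp ((ContinuousLinearMap.lsmul ℂ ℂ (E := X)).flip x)
    ((memLp_exp z).toLp _)
  filter_upwards [h1, (memLp_exp z).coeFn_toLp] with σ h2 h3
  rw [h3] at h2
  exact h2

theorem expL2_isPrimitive [CompleteSpace X] (z : ℂ) (x : X) :
    IsPrimitive x (expL2 z x) (z • expL2 z x) := by
  filter_upwards [expL2_coeFn z x, ae_restrict_mem measurableSet_Icc] with σ h1 hσ
  have h2 : (z • expL2 z x : L2Hist X) =ᵐ[histMeasure]
      fun σ : ℝ => (z * Complex.exp (z * σ)) • x := by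
    filter_upwards [Lp.coeFn_smul z (expL2 z x), expL2_coeFn z x] with σ h3 h4
    rw [h3, Pi.smul_apply, h4, smul_smul]
  rw [h1, intervalIntegral_congr_hist h2 hσ]
  have hd : ∀ s : ℝ, HasDerivAt (fun s : ℝ => Complex.exp (z * s) • x)
      ((z * Complex.exp (z * s)) • x) s := fun s => by
    have h5 : HasDerivAt (fun s : ℝ => z * (s : ℂ)) z s := by
      simpa using (Complex.ofRealCLM.hasDerivAt (x := s)).const_mul z
    have h6 := h5.cexp.smul_const x
    rwa [mul_comm] at h6
  rw [intervalIntegral.integral_eq_sub_of_hasDerivAt (fun s _ => hd s)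
    (Continuous.intervalIntegrable (by fun_prop) _ _)]
  simp

/-- The map `x ↦ ε_z ⊗ x = e^{z ·} x` from `X` to `W^{1,2}([-1,0], X)`. -/
def expW12 [CompleteSpace X] (z : ℂ) : X →L[ℂ] W12 X :=
  W12.lift (expL2 z) (z • expL2 z) (fun x => by
    rw [smul_apply]
    exact ⟨x, expL2_isPrimitive z x⟩)

/-- The operator `Φ_z ∈ ℒ(X)`, `Φ_z x = Φ(e^{z ·} x)`. -/
def delaySymbol [CompleteSpace X] (Φ : W12 X →L[ℂ] X) (z : ℂ) : X →L[ℂ] X :=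
  Φ ∘L expW12 z

end Delay

end DelayEq

end

open DelayEq

/-! The state space $X\times L^2([-1,0],X)$ is a Hilbert space, so by Gearhart–Prüss it suffices to
solve $(z-\mathcal A)q=p$ for all $\operatorname{Re}z>0$ with $\|q\|\le K\|p\|$ and $K$ independent
of $z$.

The second coordinate forces $f=e^{z\cdot}y+R(z,A_0)g$ for $p=(x,g)$, and the first one then reads
$(z-B-\Phi_z)y=x+\Phi R(z,A_0)g$. Substituting $y=R(z,B)v$ turns this into $(1-\Phi_zR(z,B))v=x+\Phi
R(z,A_0)g$, which a Neumann series solves once $\|(\Phi_zR(z,B))^n\|\le a_n$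
(`exists_delay_resolvent`). The bound on $\Phi R(z,A_0)$ is part of admissibility.

The hypothesis controls these powers only on the imaginary axis. Since $\Phi_z=\Phi_0-z\,\Phi
R(z,A_0)e_0$, where $e_0x$ is the constant function $x$, admissibility makes $\Phi_z$ holomorphic
with at most linear growth. Against the decay of $R(z,B)$ this keeps the powers bounded on the
positive real axis and of order one elsewhere, so Phragmén–Lindelöf carries each $a_n$ into the
right half-plane (`Admissible.norm_pow_le_of_imaginary_axis`).

Gearhart–Prüss is proved here by Plancherel and a quantitative Datko argument. Only the existence of
a bounded solution $q$ is required there: for large $\operatorname{Re}z$ the Laplace transform is a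
two-sided resolvent, and the growth rate is pushed down in steps of fixed size until it is negative.
-/

noncomputable section

namespace DelayEq

/-! ### Laplace transforms of orbits and growth rates -/

section LaplaceTransform

variable {E : Type*} [NormedAddCommGroup E] [NormedSpace ℂ E]

/-- `w` is an exponential growth rate of the semigroup. -/
def C0Semigroup.HasRate (T : C0Semigroup E) (w : ℝ) : Prop :=
  ∃ M : ℝ, ∀ t : ℝ≥0, ‖T.op t‖ ≤ M * Real.exp (w * t)

/-- The orbit of `x`, extended by `x` to negative times. -/
def C0Semigroup.orbit (T : C0Semigroup E) (x : E) (t : ℝ) : E := T.op t.toNNReal x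

/-- The Laplace transform of the orbit of `x`. -/
def C0Semigroup.laplace (T : C0Semigroup E) (z : ℂ) (x : E) : E :=
  ∫ t in Ioi (0 : ℝ), Complex.exp (-(z * t)) • T.orbit x t

theorem C0Semigroup.growthBound_lt_iff (T : C0Semigroup E) {a : EReal} :
    T.growthBound < a ↔ ∃ w : ℝ, (w : EReal) < a ∧ T.HasRate w := by
  simp only [C0Semigroup.growthBound, iInf_lt_iff, C0Semigroup.HasRate]
  exact exists_congr fun w => by rw [exists_prop, and_comm]

theorem C0Semigroup.continuous_orbit (T : C0Semigroup E) (x : E) : Continuous (T.orbit x) :=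
  (T.strongly_continuous x).comp continuous_real_toNNReal

theorem C0Semigroup.orbit_zero (T : C0Semigroup E) (x : E) : T.orbit x 0 = x := by
  simp [C0Semigroup.orbit, T.op_zero]

theorem C0Semigroup.op_add_apply (T : C0Semigroup E) (s t : ℝ≥0) (x : E) :
    T.op (s + t) x = T.op s (T.op t x) := by
  rw [T.op_add]; rfl

theorem C0Semigroup.op_orbit (T : C0Semigroup E) (x : E) (h : ℝ≥0) {t : ℝ} (ht : 0 ≤ t) :
    T.op h (T.orbit x t) = T.orbit x (t + h) := by
  have e : (t + h).toNNReal = h + t.toNNReal := by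
    rw [Real.toNNReal_add ht h.coe_nonneg, Real.toNNReal_coe, add_comm]
  rw [C0Semigroup.orbit, C0Semigroup.orbit, ← T.op_add_apply, e]

theorem C0Semigroup.orbit_op (T : C0Semigroup E) (x : E) (h : ℝ≥0) (t : ℝ) :
    T.orbit (T.op h x) t = T.op h (T.orbit x t) := by
  rw [C0Semigroup.orbit, C0Semigroup.orbit, ← T.op_add_apply, ← T.op_add_apply, add_comm]

theorem C0Semigroup.norm_orbit_le {T : C0Semigroup E} {M w : ℝ}
    (hT : ∀ t : ℝ≥0, ‖T.op t‖ ≤ M * Real.exp (w * t)) (x : E) {t : ℝ} (ht : 0 ≤ t) :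
    ‖T.orbit x t‖ ≤ M * Real.exp (w * t) * ‖x‖ := by
  have := hT t.toNNReal
  rw [Real.coe_toNNReal t ht] at this
  exact (T.op t.toNNReal).le_of_opNorm_le this x

theorem C0Semigroup.norm_exp_smul_orbit_le {T : C0Semigroup E} {M w : ℝ}
    (hT : ∀ t : ℝ≥0, ‖T.op t‖ ≤ M * Real.exp (w * t)) (z : ℂ) (x : E) {t : ℝ} (ht : 0 ≤ t) :
    ‖Complex.exp (-(z * t)) • T.orbit x t‖ ≤ M * ‖x‖ * Real.exp (-(z.re - w) * t) := by
  rw [norm_smul, Complex.norm_exp]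
  have h1 : (-(z * t)).re = -(z.re * t) := by simp
  rw [h1]
  calc _ ≤ Real.exp (-(z.re * t)) * (M * Real.exp (w * t) * ‖x‖) := by
        gcongr; exact norm_orbit_le hT x ht
    _ = M * ‖x‖ * (Real.exp (-(z.re * t)) * Real.exp (w * t)) := by ring
    _ = _ := by rw [← Real.exp_add]; ring_nf

theorem C0Semigroup.integrableOn_exp_smul_orbit {T : C0Semigroup E} {M w : ℝ}
    (hT : ∀ t : ℝ≥0, ‖T.op t‖ ≤ M * Real.exp (w * t)) {z : ℂ} (hz : w < z.re) (x : E) :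
    IntegrableOn (fun t : ℝ => Complex.exp (-(z * t)) • T.orbit x t) (Ioi 0) := by
  have h1 : IntegrableOn (fun t : ℝ => M * ‖x‖ * Real.exp (-(z.re - w) * t)) (Ioi 0) :=
    (exp_neg_integrableOn_Ioi 0 (sub_pos.2 hz)).const_mul _
  refine Integrable.mono' h1 ?_ ?_
  · have := T.continuous_orbit x
    exact (Continuous.aestronglyMeasurable (by fun_prop))
  · filter_upwards [ae_restrict_mem measurableSet_Ioi] with t ht
    exact norm_exp_smul_orbit_le hT z x (le_of_lt ht)

theorem C0Semigroup.norm_laplace_le {T : C0Semigroup E} {M w : ℝ}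
    (hT : ∀ t : ℝ≥0, ‖T.op t‖ ≤ M * Real.exp (w * t)) {z : ℂ} (hz : w < z.re) (x : E) :
    ‖T.laplace z x‖ ≤ M / (z.re - w) * ‖x‖ := by
  have h1 : IntegrableOn (fun t : ℝ => M * ‖x‖ * Real.exp (-(z.re - w) * t)) (Ioi 0) :=
    (exp_neg_integrableOn_Ioi 0 (sub_pos.2 hz)).const_mul _
  have h2 : ‖T.laplace z x‖ ≤ ∫ t in Ioi (0 : ℝ), M * ‖x‖ * Real.exp (-(z.re - w) * t) := by
    refine norm_integral_le_of_norm_le h1 ?_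
    filter_upwards [ae_restrict_mem measurableSet_Ioi] with t ht
    exact norm_exp_smul_orbit_le hT z x (le_of_lt ht)
  refine h2.trans_eq ?_
  rw [integral_const_mul, integral_exp_mul_Ioi (by linarith)]
  have := sub_pos.2 hz
  simp only [mul_zero, Real.exp_zero]
  rw [neg_div_neg_eq]
  ring

/-- The resolvent identity. -/
theorem C0Semigroup.resolvent_identity {T : C0Semigroup E} {z u : ℂ} {R R' : E →L[ℂ] E}
    (h : ∀ x y, T.HasGenerator x y → R y = z • R x - x)
    (h' : ∀ x, T.HasGenerator (R' x) (u • R' x - x)) (x : E) :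
    R x = R' x + (u - z) • R (R' x) := by
  have e := h _ _ (h' x)
  rw [map_sub, map_smul] at e
  rw [sub_smul, ← sub_eq_zero]
  rw [sub_eq_iff_eq_add] at e
  rw [e]
  abel

variable [CompleteSpace E]

/-- Translating the variable by $h$ turns the integral over $(0,\infty)$ into $e^{zh}$ times the
integral over $(h,\infty)$. -/
theorem C0Semigroup.op_laplace {T : C0Semigroup E} {M w : ℝ}
    (hT : ∀ t : ℝ≥0, ‖T.op t‖ ≤ M * Real.exp (w * t)) {z : ℂ} (hz : w < z.re) (x : E)
    (h : ℝ≥0) :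
    T.op h (T.laplace z x) = Complex.exp (z * h) •
      (T.laplace z x - ∫ t in (0 : ℝ)..h, Complex.exp (-(z * t)) • T.orbit x t) := by
  have hint := integrableOn_exp_smul_orbit hT hz x
  have h1 : T.op h (T.laplace z x) = ∫ t in Ioi (0 : ℝ), Complex.exp (z * h) •
      (Complex.exp (-(z * (t + h : ℝ))) • T.orbit x (t + h)) := by
    rw [C0Semigroup.laplace, ← ContinuousLinearMap.integral_comp_comm _ hint]
    refine setIntegral_congr_fun measurableSet_Ioi fun t ht => ?_
    simp only [map_smul]
    rw [T.op_orbit x h (le_of_lt ht), smul_smul, ← Complex.exp_add]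
    congr 2
    push_cast; ring
  have h2 := (measurePreserving_add_right volume (h : ℝ)).setIntegral_preimage_emb
    (measurableEmbedding_addRight (h : ℝ))
    (fun t : ℝ => Complex.exp (-(z * t)) • T.orbit x t) (Ioi (h : ℝ))
  rw [preimage_add_const_Ioi, sub_self] at h2
  rw [h1, integral_smul, h2]
  congr 1
  rw [eq_sub_iff_add_eq', C0Semigroup.laplace]
  exact intervalIntegral.integral_interval_add_Ioi hint (hint.mono_set (Ioi_subset_Ioi h.coe_nonneg))

theorem C0Semigroup.laplace_op {T : C0Semigroup E} {M w : ℝ}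
    (hT : ∀ t : ℝ≥0, ‖T.op t‖ ≤ M * Real.exp (w * t)) {z : ℂ} (hz : w < z.re) (x : E)
    (h : ℝ≥0) : T.laplace z (T.op h x) = T.op h (T.laplace z x) := by
  rw [C0Semigroup.laplace, C0Semigroup.laplace, ← ContinuousLinearMap.integral_comp_comm _
    (integrableOn_exp_smul_orbit hT hz x)]
  simp only [T.orbit_op, map_smul]

/-- Product rule at $h=0$ in `op_laplace`: the exponential factor contributes $z$ times the
transform, the truncated integral contributes $-x$. -/
theorem C0Semigroup.hasGenerator_laplace {T : C0Semigroup E} {M w : ℝ}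
    (hT : ∀ t : ℝ≥0, ‖T.op t‖ ≤ M * Real.exp (w * t)) {z : ℂ} (hz : w < z.re) (x : E) :
    T.HasGenerator (T.laplace z x) (z • T.laplace z x - x) := by
  set u : ℝ → E := fun t => Complex.exp (-(z * t)) • T.orbit x t with hu
  have huc : Continuous u := by
    have := T.continuous_orbit x
    fun_prop
  have hu0 : u 0 = x := by simp [hu, T.orbit_zero]
  have hd1 : HasDerivAt (fun h : ℝ => T.laplace z x - ∫ t in (0 : ℝ)..h, u t) (-x) 0 := by
    have := (intervalIntegral.integral_hasDerivAt_right (huc.intervalIntegrable 0 0)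
      (huc.stronglyMeasurableAtFilter _ _) huc.continuousAt).const_sub (T.laplace z x)
    rwa [hu0] at this
  have hd2 : HasDerivAt (fun h : ℝ => Complex.exp (z * h)) z 0 := by
    have h5 : HasDerivAt (fun s : ℝ => z * (s : ℂ)) z 0 := by
      simpa using (Complex.ofRealCLM.hasDerivAt (x := (0 : ℝ))).const_mul z
    simpa using h5.cexp
  have hd := hd2.smul hd1
  have hs := hd.tendsto_slope_zero_right
  have hc : Tendsto (fun t : ℝ≥0 => (t : ℝ)) (𝓝[>] 0) (𝓝[>] 0) := by
    refine tendsto_nhdsWithin_iff.2 ⟨?_, ?_⟩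
    · exact (NNReal.continuous_coe.tendsto' 0 0 rfl).mono_left nhdsWithin_le_nhds
    · filter_upwards [self_mem_nhdsWithin] with t ht
      exact_mod_cast ht
  have hs' := hs.comp hc
  have e1 : Complex.exp (z * (0 : ℝ)) • -x + z • (T.laplace z x - ∫ t in (0 : ℝ)..0, u t) =
      z • T.laplace z x - x := by simp; abel
  rw [e1] at hs'
  refine hs'.congr fun t => ?_
  rw [op_laplace hT hz]
  simp only [Function.comp, zero_add]
  rw [← Complex.ofReal_inv, Complex.coe_smul]
  simp [hu]

theorem C0Semigroup.exists_laplace {T : C0Semigroup E} {M w : ℝ}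
    (hT : ∀ t : ℝ≥0, ‖T.op t‖ ≤ M * Real.exp (w * t)) :
    ∃ L : ℂ → E →L[ℂ] E, ∀ z : ℂ, w < z.re →
      (∀ x, L z x = T.laplace z x) ∧ ‖L z‖ ≤ M / (z.re - w) ∧
      (∀ x, T.HasGenerator (L z x) (z • L z x - x)) ∧
      ∀ x y, T.HasGenerator x y → L z y = z • L z x - x := by
  have hM : 0 ≤ M := by
    have := (norm_nonneg _).trans (hT 0)
    simpa using this
  have key : ∀ z : ℂ, ∃ L : E →L[ℂ] E, w < z.re →
      (∀ x, L x = T.laplace z x) ∧ ‖L‖ ≤ M / (z.re - w) := by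
    intro z
    by_cases hz : w < z.re
    swap
    · exact ⟨0, fun h => absurd h hz⟩
    refine ⟨LinearMap.mkContinuous
      { toFun := T.laplace z
        map_add' := fun x y => ?_
        map_smul' := fun c x => ?_ } (M / (z.re - w)) (norm_laplace_le hT hz), fun _ =>
        ⟨fun x => rfl, LinearMap.mkContinuous_norm_le _ (div_nonneg hM (sub_pos.2 hz).le) _⟩⟩
    · rw [C0Semigroup.laplace, C0Semigroup.laplace, C0Semigroup.laplace, ← integral_add
        (integrableOn_exp_smul_orbit hT hz x) (integrableOn_exp_smul_orbit hT hz y)]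
      simp only [C0Semigroup.orbit, map_add, smul_add]
    · simp only [C0Semigroup.laplace, C0Semigroup.orbit, map_smul, RingHom.id_apply]
      rw [← integral_smul]
      simp only [smul_comm c]
  choose L hL using key
  refine ⟨L, fun z hz => ⟨(hL z hz).1, (hL z hz).2, fun x => ?_, fun x y hxy => ?_⟩⟩
  · rw [(hL z hz).1]
    exact hasGenerator_laplace hT hz x
  -- Left inverse: $L(z)$ commutes with the semigroup, so it maps the difference quotients of $x$ to
  -- those of $L(z)x$, whose limit is known.
  · have h1 := ((L z).continuous.tendsto y).comp hxy
    have h2 := hasGenerator_laplace hT hz x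
    rw [← (hL z hz).1] at h2
    refine tendsto_nhds_unique (h1.congr fun t => ?_) h2
    simp only [Function.comp, map_smul, map_sub]
    rw [(hL z hz).1 (T.op t x), laplace_op hT hz, (hL z hz).1]

theorem C0Semigroup.exists_bound_of_le (T : C0Semigroup E) (a : ℝ≥0) :
    ∃ K : ℝ, 1 ≤ K ∧ ∀ t ≤ a, ‖T.op t‖ ≤ K := by
  obtain ⟨C, hC⟩ := banach_steinhaus (g := fun t : Icc (0 : ℝ≥0) a => T.op t) fun x => by
    obtain ⟨C, hC⟩ := (isCompact_Icc (a := (0 : ℝ≥0)) (b := a)).exists_bound_of_continuousOn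
      (T.strongly_continuous x).continuousOn
    exact ⟨C, fun t => hC t t.2⟩
  exact ⟨max 1 C, le_max_left _ _, fun t ht =>
    (hC ⟨t, zero_le, ht⟩).trans (le_max_right _ _)⟩

/-- A single time determines a rate: write $t=na+r$ with $0\le r\le a$. The factor $e^{|w|a}$
absorbs $e^{-wr}$ for either sign of $w$. -/
theorem C0Semigroup.hasRate_of_norm_op_le {T : C0Semigroup E} {a : ℝ≥0} (ha : 0 < a) {w : ℝ}
    (h : ‖T.op a‖ ≤ Real.exp (w * a)) : T.HasRate w := by
  obtain ⟨K, hK1, hK⟩ := T.exists_bound_of_le a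
  have hpow : ∀ n : ℕ, ‖T.op (n * a)‖ ≤ Real.exp (w * (n * a)) := by
    intro n
    induction n with
    | zero =>
      simpa [T.op_zero] using ContinuousLinearMap.norm_id_le
    | succ n ih =>
      have e : ((n + 1 : ℕ) : ℝ≥0) * a = n * a + a := by push_cast; ring
      rw [e, T.op_add]
      refine (ContinuousLinearMap.opNorm_comp_le _ _).trans ?_
      refine (mul_le_mul ih h (norm_nonneg _) (Real.exp_nonneg _)).trans_eq ?_
      rw [← Real.exp_add]; push_cast; ring_nf
  refine ⟨K * Real.exp (|w| * a), fun t => ?_⟩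
  set n := ⌊t / a⌋₊
  have hn : n * a ≤ t := by
    rw [← le_div_iff₀ ha]; exact Nat.floor_le zero_le
  have hn' : t - n * a ≤ a := by
    rw [tsub_le_iff_left]
    have := (Nat.lt_floor_add_one (t / a)).le
    rw [div_le_iff₀ ha] at this
    calc t ≤ _ := this
      _ = n * a + a := by ring
  have et : t = n * a + (t - n * a) := (add_tsub_cancel_of_le hn).symm
  have h1 : ‖T.op t‖ ≤ Real.exp (w * (n * a)) * K := by
    rw [et, T.op_add]
    exact (ContinuousLinearMap.opNorm_comp_le _ _).trans
      (mul_le_mul (hpow n) (hK _ hn') (norm_nonneg _) (Real.exp_nonneg _))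
  refine h1.trans ?_
  rw [mul_comm, mul_assoc, ← Real.exp_add]
  gcongr
  have e2 : (t : ℝ) = n * a + (t - n * a : ℝ≥0) := by exact_mod_cast congrArg NNReal.toReal et
  have h3 : -(w * (t - n * a : ℝ≥0)) ≤ |w| * a := by
    calc -(w * ((t - n * a : ℝ≥0) : ℝ)) ≤ |w * ((t - n * a : ℝ≥0) : ℝ)| := neg_le_abs _
      _ = |w| * ((t - n * a : ℝ≥0) : ℝ) := by rw [abs_mul, NNReal.abs_eq]
      _ ≤ _ := by gcongr
  rw [e2]
  linarith

theorem C0Semigroup.exists_hasRate (T : C0Semigroup E) : ∃ w : ℝ, 0 ≤ w ∧ T.HasRate w := by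
  refine ⟨max 0 (Real.log (max 1 ‖T.op 1‖)), le_max_left _ _,
    hasRate_of_norm_op_le one_pos ?_⟩
  have h1 : 0 < max 1 ‖T.op 1‖ := lt_of_lt_of_le one_pos (le_max_left _ _)
  calc ‖T.op 1‖ ≤ max 1 ‖T.op 1‖ := le_max_right _ _
    _ = Real.exp (Real.log (max 1 ‖T.op 1‖)) := (Real.exp_log h1).symm
    _ ≤ _ := by
      rw [Real.exp_le_exp, NNReal.coe_one, mul_one]; exact le_max_right _ _

end LaplaceTransform

/-! ### Plancherel's identity for Hilbert-space-valued functions -/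

section Plancherel

open scoped FourierTransform SchwartzMap ContDiff

variable {H : Type*} [NormedAddCommGroup H] [InnerProductSpace ℂ H] [CompleteSpace H]

/-- On `L¹ ∩ L²` the `L²`-Fourier transform is given by the Fourier integral. -/
theorem coeFn_fourier_toLp {g : ℝ → H} (h1 : Integrable g) (h2 : MemLp g 2) :
    (𝓕 (h2.toLp g) : Lp H 2 (volume : Measure ℝ)) =ᵐ[volume] 𝓕 g := by
  have hc : Continuous (𝓕 g) :=
    VectorFourier.fourierIntegral_continuous Real.continuous_fourierChar
      (by fun_prop) h1
  -- Test both sides against smooth compactly supported functions. The $L^2$ transform agrees with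
  -- the distributional one, and the Fourier integral moves onto the test function by Fubini.
  refine ae_eq_of_integral_contDiff_smul_eq ((Lp.memLp _).locallyIntegrable (by norm_num))
    hc.locallyIntegrable fun φ hφ hφc => ?_
  have hg₁ : HasCompactSupport (Complex.ofRealCLM ∘ φ) := hφc.comp_left rfl
  have hg₂ : ContDiff ℝ ∞ (Complex.ofRealCLM ∘ φ) := by fun_prop
  set ψ : 𝓢(ℝ, ℂ) := hg₁.toSchwartzMap hg₂ with hψ
  have hψφ : ∀ x, ψ x = (φ x : ℂ) := fun x => rfl
  have e1 := congrArg (fun D => D ψ) (Lp.fourier_toTemperedDistribution_eq (h2.toLp g))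
  simp only [TemperedDistribution.fourier_apply, Lp.toTemperedDistribution_apply] at e1
  have e2 : ∫ x, (𝓕 ψ) x • (h2.toLp g) x = ∫ x, (𝓕 (ψ : ℝ → ℂ)) x • g x := by
    refine integral_congr_ae ?_
    filter_upwards [h2.coeFn_toLp] with x hx
    rw [hx, SchwartzMap.fourier_coe]
  have e3 : ∫ x, (𝓕 (ψ : ℝ → ℂ)) x • g x = ∫ x, ψ x • (𝓕 g) x := by
    have := VectorFourier.integral_fourierIntegral_smul_eq_flip (L := innerₗ ℝ) (μ := volume)
      Real.continuous_fourierChar (by fun_prop) ψ.integrable h1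
    rwa [flip_innerₗ] at this
  rw [e2, e3] at e1
  simp only [hψφ, Complex.coe_smul] at e1
  exact e1.symm

theorem eLpNorm_fourier {g : ℝ → H} (h1 : Integrable g) (h2 : MemLp g 2) :
    eLpNorm (𝓕 g) 2 volume = eLpNorm g 2 volume := by
  rw [← eLpNorm_congr_ae (coeFn_fourier_toLp h1 h2), ← eLpNorm_congr_ae h2.coeFn_toLp,
    ← Lp.enorm_def, ← Lp.enorm_def, enorm_eq_iff_norm_eq, Lp.norm_fourier_eq]

end Plancherel

/-! ### Datko's argument and the Gearhart–Prüss theorem -/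

section Gearhart

open scoped FourierTransform

/-- The orbit of `x` under `e^{-wt} T(t)`, extended by zero to negative times. -/
def C0Semigroup.dampedOrbit {E : Type*} [NormedAddCommGroup E] [NormedSpace ℂ E]
    (T : C0Semigroup E) (w : ℝ) (x : E) : ℝ → E :=
  (Ioi (0 : ℝ)).indicator fun t => Complex.exp (-((w : ℂ) * t)) • T.orbit x t

theorem mul_sqrt_le_of_le_eLpNorm {F : Type*} [NormedAddCommGroup F] {g : ℝ → F} {c C : ℝ} {a b : ℝ} (hab : a ≤ b) (hc : 0 ≤ c)
    (hC : 0 ≤ C) (hg : ∀ s ∈ Ioc a b, c ≤ ‖g s‖) (h : eLpNorm g 2 volume ≤ ENNReal.ofReal C) :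
    c * √(b - a) ≤ C := by
  have h1 : eLpNorm (fun _ : ℝ => c) 2 (volume.restrict (Ioc a b)) ≤ eLpNorm g 2 volume := by
    refine (eLpNorm_mono_ae ?_).trans (eLpNorm_restrict_le g 2 volume (Ioc a b))
    filter_upwards [ae_restrict_mem measurableSet_Ioc] with s hs
    rw [Real.norm_of_nonneg hc]
    exact hg s hs
  rw [eLpNorm_const' _ (by norm_num) (by norm_num), Measure.restrict_apply_univ,
    Real.volume_Ioc] at h1
  have h2 := h1.trans h
  rw [← ofReal_norm, Real.norm_of_nonneg hc, ENNReal.ofReal_rpow_of_nonneg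
    (by linarith) (by norm_num), ← ENNReal.ofReal_mul hc, ENNReal.ofReal_le_ofReal_iff hC] at h2
  rw [Real.sqrt_eq_rpow]
  simpa using h2

variable {H : Type*} [NormedAddCommGroup H] [InnerProductSpace ℂ H]

theorem C0Semigroup.integrable_dampedOrbit {T : C0Semigroup H} {M v w : ℝ}
    (hT : ∀ t : ℝ≥0, ‖T.op t‖ ≤ M * Real.exp (v * t)) (hw : v < w) (x : H) :
    Integrable (T.dampedOrbit w x) :=
  (integrable_indicator_iff measurableSet_Ioi).2
    (integrableOn_exp_smul_orbit hT (z := (w : ℂ)) (by simpa using hw) x)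

/-- This turns resolvent bounds on vertical lines into $L^2$ bounds on orbits; the $2\pi$ comes from
the normalisation $e^{-2\pi ist}$. -/
theorem C0Semigroup.fourier_dampedOrbit (T : C0Semigroup H) (w : ℝ) (x : H) (s : ℝ) :
    𝓕 (T.dampedOrbit w x) s = T.laplace (w + (2 * Real.pi * s : ℝ) * Complex.I) x := by
  rw [Real.fourier_real_eq_integral_exp_smul, C0Semigroup.laplace,
    ← integral_indicator measurableSet_Ioi]
  congr 1
  ext t
  by_cases ht : t ∈ Ioi (0 : ℝ)
  · rw [indicator_of_mem ht, C0Semigroup.dampedOrbit, indicator_of_mem ht, smul_smul,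
      ← Complex.exp_add]
    congr 2
    push_cast; ring
  · rw [indicator_of_notMem ht, C0Semigroup.dampedOrbit, indicator_of_notMem ht, smul_zero]

/-- The orbit is dominated by the square-integrable $Me^{-(w-v)t}\|x\|$. This constant degenerates
as $w\downarrow v$, so it is used quantitatively only at one fixed rate. -/
theorem C0Semigroup.exists_eLpNorm_dampedOrbit_le {T : C0Semigroup H} {M v w : ℝ}
    (hT : ∀ t : ℝ≥0, ‖T.op t‖ ≤ M * Real.exp (v * t)) (hw : v < w) :
    ∃ C : ℝ≥0, ∀ x, eLpNorm (T.dampedOrbit w x) 2 volume ≤ C * ‖x‖ₑ := by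
  set e : ℝ → ℝ := (Ioi (0 : ℝ)).indicator fun t => M * Real.exp (-(w - v) * t)
  have he : MemLp e 2 volume := by
    rw [memLp_indicator_iff_restrict measurableSet_Ioi]
    have hm : AEStronglyMeasurable (fun t : ℝ => M * Real.exp (-(w - v) * t))
      (volume.restrict (Ioi 0)) := Continuous.aestronglyMeasurable (by fun_prop)
    rw [memLp_two_iff_integrable_sq hm]
    have := (exp_neg_integrableOn_Ioi 0 (b := 2 * (w - v)) (by linarith)).const_mul (M ^ 2)
    refine this.congr (Eventually.of_forall fun t => ?_)
    simp only [mul_pow, ← Real.exp_nat_mul]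
    push_cast; ring_nf
  refine ⟨(eLpNorm e 2 volume).toNNReal, fun x => ?_⟩
  rw [ENNReal.coe_toNNReal he.2.ne]
  have := eLpNorm_le_nnreal_smul_eLpNorm_of_ae_le_mul (μ := volume) (f := T.dampedOrbit w x)
    (g := e) (c := ‖x‖₊) (Eventually.of_forall fun t => ?_) 2
  · rw [mul_comm]; simpa [ENNReal.smul_def, enorm_eq_nnnorm] using this
  · rw [← NNReal.coe_le_coe]
    simp only [NNReal.coe_mul, coe_nnnorm]
    by_cases ht : t ∈ Ioi (0 : ℝ)
    · simp only [e, C0Semigroup.dampedOrbit, indicator_of_mem ht]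
      refine (norm_exp_smul_orbit_le hT _ x (le_of_lt ht)).trans ?_
      rw [mul_comm M, mul_assoc, Complex.ofReal_re]
      gcongr
      exact Real.le_norm_self _
    · simp only [e, C0Semigroup.dampedOrbit, indicator_of_notMem ht]
      simp

theorem C0Semigroup.memLp_dampedOrbit {T : C0Semigroup H} {M v w : ℝ}
    (hT : ∀ t : ℝ≥0, ‖T.op t‖ ≤ M * Real.exp (v * t)) (hw : v < w) (x : H) :
    MemLp (T.dampedOrbit w x) 2 := by
  obtain ⟨C, hC⟩ := exists_eLpNorm_dampedOrbit_le hT hw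
  exact ⟨(integrable_dampedOrbit hT hw x).1, (hC x).trans_lt
    (ENNReal.mul_lt_top ENNReal.coe_lt_top enorm_lt_top)⟩

/-- A quantitative form of Datko's theorem. -/
theorem C0Semigroup.norm_op_le_of_eLpNorm_dampedOrbit_le {T : C0Semigroup H} {w C K : ℝ}
    (hw : 0 ≤ w) (hC : 0 ≤ C) (hK1 : 1 ≤ K) (hK : ∀ t ≤ 1, ‖T.op t‖ ≤ K)
    (h : ∀ x, eLpNorm (T.dampedOrbit w x) 2 volume ≤ ENNReal.ofReal (C * ‖x‖))
    {a : ℝ≥0} (ha : 2 * (K * (C + 1) * C) ≤ √a) (ha0 : 0 < a) :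
    ‖T.op a‖ ≤ Real.exp (w * a) / 2 := by
  have hd : ∀ x, ∀ s : ℝ≥0, 0 < s → ‖T.dampedOrbit w x s‖ = Real.exp (-(w * s)) * ‖T.op s x‖ := by
    intro x s hs
    rw [C0Semigroup.dampedOrbit, indicator_of_mem (by exact_mod_cast hs), norm_smul,
      Complex.norm_exp, C0Semigroup.orbit, Real.toNNReal_coe]
    simp
  -- The semigroup law for $e^{-wt}T(t)$: a large value at time $t$ forces comparably large values
  -- at earlier times $s$.
  have hexp : ∀ x, ∀ s t : ℝ≥0, s ≤ t → ∀ N : ℝ,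
      (Real.exp (-(w * (t - s : ℝ≥0))) * ‖T.op (t - s)‖ ≤ N) →
      Real.exp (-(w * t)) * ‖T.op t x‖ ≤ N * (Real.exp (-(w * s)) * ‖T.op s x‖) := by
    intro x s t hst N hN
    have et : t = (t - s) + s := (tsub_add_cancel_of_le hst).symm
    have e2 : (t : ℝ) = (t - s : ℝ≥0) + s := by exact_mod_cast congrArg NNReal.toReal et
    have h1 : ‖T.op t x‖ ≤ ‖T.op (t - s)‖ * ‖T.op s x‖ := by
      conv_lhs => rw [et, T.op_add_apply]
      exact ContinuousLinearMap.le_opNorm _ _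
    have h2 : Real.exp (-(w * t)) = Real.exp (-(w * (t - s : ℝ≥0))) * Real.exp (-(w * s)) := by
      rw [← Real.exp_add, e2]; ring_nf
    calc _ ≤ Real.exp (-(w * t)) * (‖T.op (t - s)‖ * ‖T.op s x‖) := by gcongr
      _ = (Real.exp (-(w * (t - s : ℝ≥0))) * ‖T.op (t - s)‖) *
          (Real.exp (-(w * s)) * ‖T.op s x‖) := by rw [h2]; ring
      _ ≤ _ := by gcongr
  have hsmall : ∀ t : ℝ≥0, t ≤ 1 → Real.exp (-(w * t)) * ‖T.op t‖ ≤ K := by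
    intro t ht
    calc _ ≤ 1 * K := by
          gcongr
          · exact Real.exp_le_one_iff.2 (neg_nonpos.2 (by positivity))
          · exact hK t ht
      _ = K := one_mul _
  -- By `hexp` the damped orbit has norm at least $e^{-wt}\|T(t)x\|/N$ on $(b,t]$; compare with its
  -- $L^2$ norm.
  have key : ∀ x, ∀ t : ℝ≥0, ∀ b : ℝ≥0, b < t → ∀ N : ℝ, 0 < N →
      (∀ r : ℝ≥0, r ≤ t - b → Real.exp (-(w * r)) * ‖T.op r‖ ≤ N) →
      Real.exp (-(w * t)) * ‖T.op t x‖ * √(t - b) ≤ N * C * ‖x‖ := by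
    intro x t b hb N hN hr
    have := mul_sqrt_le_of_le_eLpNorm (g := T.dampedOrbit w x)
      (c := Real.exp (-(w * t)) * ‖T.op t x‖ / N) (C := C * ‖x‖) (a := b) (b := t)
      (by exact_mod_cast hb.le) (by positivity) (by positivity) ?_ (h x)
    · rw [div_mul_eq_mul_div, div_le_iff₀ hN] at this
      linarith
    · intro s hs
      lift s to ℝ≥0 using (b.2.trans hs.1.le)
      have hs1 : b < s := by exact_mod_cast hs.1
      have hs2 : s ≤ t := by exact_mod_cast hs.2
      rw [hd x s (lt_of_le_of_lt zero_le hs1), div_le_iff₀' hN]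
      exact hexp x s t hs2 N (hr _ (tsub_le_tsub_left hs1.le t))
  have hKpos : 0 < K := by linarith
  -- First pass: a window of length one, where $N=K$ suffices, gives boundedness in $t$.
  have hbound : ∀ t : ℝ≥0, Real.exp (-(w * t)) * ‖T.op t‖ ≤ K * (C + 1) := by
    intro t
    rcases le_or_gt t 1 with ht | ht
    · refine (hsmall t ht).trans ?_
      nlinarith
    · rw [← le_div_iff₀' (Real.exp_pos _)]
      refine ContinuousLinearMap.opNorm_le_bound _ (by positivity) fun x => ?_
      have := key x t (t - 1) (tsub_lt_self (by positivity) one_pos) K hKpos fun r hr =>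
        hsmall r (hr.trans (by rw [tsub_tsub_cancel_of_le ht.le]))
      rw [NNReal.coe_sub ht.le, NNReal.coe_one, sub_sub_cancel, Real.sqrt_one, mul_one] at this
      rw [div_mul_eq_mul_div, le_div_iff₀' (Real.exp_pos _)]
      refine this.trans ?_
      gcongr
      linarith
  refine ContinuousLinearMap.opNorm_le_bound _ (by positivity) fun x => ?_
  -- Second pass: with boundedness known, the window is all of $(0,a]$. This gains $a^{-1/2}$, and
  -- $a$ is large enough to make that factor yield $1/2$.
  have h1 := key x a 0 ha0 (K * (C + 1)) (by positivity) fun r _ => hbound r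
  rw [NNReal.coe_zero, sub_zero] at h1
  have hsq : 0 < √(a : ℝ) := Real.sqrt_pos.2 (by exact_mod_cast ha0)
  have h2 : Real.exp (-(w * a)) * ‖T.op a x‖ * √a ≤ (‖x‖ / 2) * √a := by
    calc _ ≤ K * (C + 1) * C * ‖x‖ := h1
      _ = (‖x‖ / 2) * (2 * (K * (C + 1) * C)) := by ring
      _ ≤ _ := by gcongr
  have h3 := le_of_mul_le_mul_right h2 hsq
  rw [Real.exp_neg, inv_mul_le_iff₀ (Real.exp_pos _)] at h3
  linarith

variable [CompleteSpace H]

/-- The `L²` norms of orbits, damped at any rate at which they decay, are bounded uniformly in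
terms of a bound of the resolvent in the right half-plane. -/
theorem C0Semigroup.eLpNorm_dampedOrbit_le_mul {T : C0Semigroup H} {M v K w w₀ : ℝ}
    (hT : ∀ t : ℝ≥0, ‖T.op t‖ ≤ M * Real.exp (v * t))
    (hR : ∀ z : ℂ, 0 < z.re → ∀ x, ∃ y, T.HasGenerator y (z • y - x) ∧
      ‖y‖ ≤ K * ‖x‖) (hw : v < w) (h0 : 0 < w) (hw₀ : w ≤ w₀) (x : H) :
    eLpNorm (T.dampedOrbit w x) 2 volume ≤
      ENNReal.ofReal (1 + w₀ * K) * eLpNorm (T.dampedOrbit w₀ x) 2 volume := by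
  obtain ⟨L, hL⟩ := exists_laplace hT
  -- By Plancherel it is enough to compare the two Laplace transforms pointwise on the lines
  -- $\operatorname{Re}=w$ and $\operatorname{Re}=w_0$.
  rw [← eLpNorm_fourier (integrable_dampedOrbit hT hw x) (memLp_dampedOrbit hT hw x),
    ← eLpNorm_fourier (integrable_dampedOrbit hT (hw.trans_le hw₀) x)
      (memLp_dampedOrbit hT (hw.trans_le hw₀) x)]
  refine eLpNorm_le_mul_eLpNorm_of_ae_le_mul (Eventually.of_forall fun s => ?_) 2
  rw [fourier_dampedOrbit, fourier_dampedOrbit]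
  set z : ℂ := w + (2 * Real.pi * s : ℝ) * Complex.I with hz
  set z₀ : ℂ := w₀ + (2 * Real.pi * s : ℝ) * Complex.I with hz₀
  have hzr : z.re = w := by simp [hz]
  have hz₀r : z₀.re = w₀ := by simp [hz₀]
  obtain ⟨h1, -, -, h4⟩ := hL z (by rw [hzr]; exact hw)
  obtain ⟨g1, -, g3, -⟩ := hL z₀ (by rw [hz₀r]; linarith)
  rw [← h1, ← g1]
  -- The left-inverse property identifies the solution supplied by `hR` with $L(z)u$.
  have hb : ∀ u, ‖L z u‖ ≤ K * ‖u‖ := by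
    intro u
    obtain ⟨y, hy, hyn⟩ := hR z (by rw [hzr]; exact h0) u
    have := h4 y _ hy
    rw [map_sub, map_smul, sub_right_inj] at this
    rwa [this]
  -- $L(z)=L(z_0)+(z_0-z)L(z)L(z_0)$, and $|z_0-z|\le w_0$ because the imaginary parts agree.
  have e' := resolvent_identity h4 g3 x
  have hzz : ‖z₀ - z‖ ≤ w₀ := by
    have : z₀ - z = ((w₀ - w : ℝ) : ℂ) := by simp [hz, hz₀]
    rw [this, Complex.norm_real, Real.norm_of_nonneg (by linarith)]
    linarith
  calc ‖L z x‖ ≤ ‖L z₀ x‖ + ‖z₀ - z‖ * ‖L z (L z₀ x)‖ := by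
        rw [e']; exact (norm_add_le _ _).trans (by rw [norm_smul])
    _ ≤ ‖L z₀ x‖ + w₀ * (K * ‖L z₀ x‖) := by
        gcongr
        · linarith
        · exact hb _
    _ = _ := by ring

/-- The Gearhart–Prüss theorem: if the resolvent of the generator exists and is bounded in the
open right half-plane, the semigroup is uniformly exponentially stable. -/
theorem C0Semigroup.growthBound_neg_of_resolvent_bounded (T : C0Semigroup H) {K : ℝ}
    (hK : 0 ≤ K) (hR : ∀ z : ℂ, 0 < z.re → ∀ x, ∃ y, T.HasGenerator y (z • y - x) ∧
      ‖y‖ ≤ K * ‖x‖) : T.growthBound < 0 := by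
  obtain ⟨v₀, hv₀, M₀, hM₀⟩ := T.exists_hasRate
  obtain ⟨C₀, hC₀⟩ := exists_eLpNorm_dampedOrbit_le hM₀ (lt_add_one v₀)
  obtain ⟨N, hN1, hN⟩ := T.exists_bound_of_le 1
  -- The reference rate is $v_0+1$. Both $C$ and the time $a$ are fixed before any smaller rate is
  -- considered, so every descent step has the same size.
  set C : ℝ := (1 + (v₀ + 1) * K) * C₀ with hCdef
  have hC : 0 ≤ C := by positivity
  set a : ℝ≥0 := ((2 * (N * (C + 1) * C)) ^ 2 + 1).toNNReal with hadef
  have hacoe : (a : ℝ) = (2 * (N * (C + 1) * C)) ^ 2 + 1 := Real.coe_toNNReal _ (by positivity)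
  have ha0 : 0 < a := by rw [hadef, Real.toNNReal_pos]; positivity
  have ha : 2 * (N * (C + 1) * C) ≤ √a := by
    rw [hacoe]
    exact Real.le_sqrt_of_sq_le (by linarith)
  have hstep : ∀ v w, T.HasRate v → v < w → 0 < w → w ≤ v₀ + 1 →
      ‖T.op a‖ ≤ Real.exp (w * a) / 2 := by
    rintro v w ⟨M, hM⟩ hvw hw hw1
    refine norm_op_le_of_eLpNorm_dampedOrbit_le hw.le hC hN1 hN (fun x => ?_) ha ha0
    refine (eLpNorm_dampedOrbit_le_mul hM hR hvw hw hw1 x).trans ?_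
    calc _ ≤ ENNReal.ofReal (1 + (v₀ + 1) * K) * (C₀ * ‖x‖ₑ) := by gcongr; exact hC₀ x
      _ = _ := by
        rw [hCdef, ENNReal.ofReal_mul hC, ENNReal.ofReal_mul (by positivity),
          ENNReal.ofReal_coe_nnreal, ofReal_norm, mul_assoc]
  have ha0' : (0 : ℝ) < a := by exact_mod_cast ha0
  -- Chosen so that $e^{(v+\eta)a}/2\le e^{(v-\eta)a}$; the cap $1$ keeps $v+\eta\le v_0+1$.
  set η : ℝ := min 1 (Real.log 2 / (2 * a)) with hη
  have hlog : 0 < Real.log 2 := Real.log_pos (by norm_num)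
  have hη0 : 0 < η := lt_min one_pos (by positivity)
  have hη2 : 2 * η * a ≤ Real.log 2 := by
    have : η ≤ Real.log 2 / (2 * a) := min_le_right _ _
    rw [le_div_iff₀ (by positivity)] at this
    linarith
  have hdown : ∀ v, T.HasRate v → 0 ≤ v → v ≤ v₀ → T.HasRate (v - η) := by
    intro v hv h0 h1
    refine hasRate_of_norm_op_le ha0 ((hstep v (v + η) hv (by linarith) (by linarith)
      (by linarith [min_le_left 1 (Real.log 2 / (2 * a))])).trans ?_)
    have : Real.exp ((v + η) * a) / 2 = Real.exp ((v + η) * a - Real.log 2) := by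
      rw [Real.exp_sub, Real.exp_log (by norm_num)]
    rw [this, Real.exp_le_exp]
    linarith
  rw [T.growthBound_lt_iff]
  -- If no rate were negative, the descent by $\eta$ could be repeated forever from $v_0$, which is
  -- absurd.
  by_contra! hcon
  have hnn : ∀ v, T.HasRate v → 0 ≤ v := fun v hv => by
    by_contra! hv0
    exact hcon v (by exact_mod_cast hv0) hv
  have hall : ∀ n : ℕ, T.HasRate (v₀ - n * η) := by
    intro n
    induction n with
    | zero =>
      rw [Nat.cast_zero, zero_mul, sub_zero]
      exact ⟨M₀, hM₀⟩
    | succ n ih =>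
      have := hdown _ ih (hnn _ ih) (by have : 0 ≤ n * η := by positivity
                                        linarith)
      convert this using 1
      push_cast; ring
  obtain ⟨n, hn⟩ := exists_nat_gt (v₀ / η)
  rw [div_lt_iff₀ hη0] at hn
  linarith [hnn _ (hall n)]

end Gearhart

/-! ### The Volterra operator solving $u'=zu+f$, $u(0)=0$ -/

section Volterra

variable {X : Type*} [NormedAddCommGroup X] [NormedSpace ℂ X]

/-- Interchange of the order of integration over a triangle. -/
theorem integral_integral_triangle [CompleteSpace X] {c : ℝ × ℝ → ℂ} (hc : Continuous c) {h : ℝ → X} {σ : ℝ}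
    (hσ : σ ≤ 0) (hh : IntegrableOn h (Ioc σ 0)) :
    ∫ τ in (0 : ℝ)..σ, ∫ s in (0 : ℝ)..τ, c (τ, s) • h s =
      ∫ s in (0 : ℝ)..σ, (∫ τ in s..σ, c (τ, s)) • h s := by
  set μ : Measure ℝ := volume.restrict (Ioc σ 0)
  set G : ℝ → ℝ → X := fun τ s => {p : ℝ × ℝ | p.1 < p.2}.indicator (fun p => c p • h p.2) (τ, s)
  have hL : ∫ τ in (0 : ℝ)..σ, ∫ s in (0 : ℝ)..τ, c (τ, s) • h s = ∫ τ, ∫ s, G τ s ∂μ ∂μ := by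
    rw [intervalIntegral.integral_of_ge hσ, ← integral_neg]
    refine setIntegral_congr_fun measurableSet_Ioc fun τ hτ => ?_
    rw [intervalIntegral.integral_of_ge hτ.2, neg_neg]
    have e : ∀ s, G τ s = (Ioi τ).indicator (fun s => c (τ, s) • h s) s := fun s => by
      simp only [G, indicator_apply, mem_ofPred_eq, mem_Ioi]
    simp only [e]
    rw [integral_indicator measurableSet_Ioi, Measure.restrict_restrict measurableSet_Ioi]
    congr 2
    ext s
    simp only [mem_inter_iff, mem_Ioi, mem_Ioc]
    exact ⟨fun h => ⟨h.1, hτ.1.trans h.1, h.2⟩, fun h => ⟨h.1, h.2.2⟩⟩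
  have hR : ∫ s in (0 : ℝ)..σ, (∫ τ in s..σ, c (τ, s)) • h s = ∫ s, ∫ τ, G τ s ∂μ ∂μ := by
    rw [intervalIntegral.integral_of_ge hσ, ← integral_neg]
    refine setIntegral_congr_fun measurableSet_Ioc fun s hs => ?_
    have e : ∀ τ, G τ s = (Iio s).indicator (fun τ => c (τ, s) • h s) τ := fun τ => by
      simp only [G, indicator_apply, mem_ofPred_eq, mem_Iio]
    simp only [e]
    rw [integral_indicator measurableSet_Iio, Measure.restrict_restrict measurableSet_Iio,
      intervalIntegral.integral_of_ge hs.1.le, neg_smul, neg_neg, ← integral_smul_const]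
    rw [← restrict_Ioo_eq_restrict_Ioc]
    congr 2
    ext τ
    simp only [mem_inter_iff, mem_Iio, mem_Ioc, mem_Ioo]
    exact ⟨fun h => ⟨h.2, h.1, h.2.le.trans hs.2⟩, fun h => ⟨h.2.1, h.1⟩⟩
  rw [hL, hR]
  refine integral_integral_swap ?_
  have hm : MeasurableSet {p : ℝ × ℝ | p.1 < p.2} := measurableSet_lt measurable_fst measurable_snd
  refine Integrable.indicator ?_ hm
  obtain ⟨C, hC⟩ := (isCompact_Icc (a := σ) (b := 0)).prod (isCompact_Icc (a := σ) (b := 0))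
    |>.exists_bound_of_continuousOn hc.continuousOn
  have hi : Integrable (fun p : ℝ × ℝ => h p.2) (μ.prod μ) := Integrable.comp_snd hh μ
  refine hi.bdd_smul C hc.aestronglyMeasurable ?_
  have : ∀ᵐ p ∂(μ.prod μ), p ∈ Ioc σ 0 ×ˢ Ioc σ 0 := by
    rw [Measure.prod_restrict]
    exact ae_restrict_mem (measurableSet_Ioc.prod measurableSet_Ioc)
  filter_upwards [this] with p hp
  exact hC p ⟨Ioc_subset_Icc_self hp.1, Ioc_subset_Icc_self hp.2⟩

/-- The function `σ ↦ ∫₀^σ e^{z(σ-s)} f(s) ds`. -/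
def volterraFun (z : ℂ) (f : ℝ → X) (σ : ℝ) : X :=
  ∫ s in (0 : ℝ)..σ, Complex.exp (z * (σ - s)) • f s

theorem volterraFun_eq (z : ℂ) (f : ℝ → X) (σ : ℝ) :
    volterraFun z f σ = Complex.exp (z * σ) • ∫ s in (0 : ℝ)..σ, Complex.exp (-(z * s)) • f s := by
  rw [volterraFun, ← intervalIntegral.integral_smul]
  congr 1
  ext s
  rw [smul_smul, ← Complex.exp_add]
  ring_nf

theorem integral_kernel_left (z : ℂ) (s σ : ℝ) :
    ∫ τ in s..σ, z * Complex.exp (z * (τ - s)) = Complex.exp (z * (σ - s)) - 1 := by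
  have hd : ∀ t : ℝ, HasDerivAt (fun t : ℝ => Complex.exp (z * (t - s)))
      (z * Complex.exp (z * (t - s))) t := fun t => by
    have h5 : HasDerivAt (fun t : ℝ => z * ((t : ℂ) - s)) z t := by
      simpa using ((Complex.ofRealCLM.hasDerivAt (x := t)).sub_const (s : ℂ)).const_mul z
    have h6 := h5.cexp
    rwa [mul_comm] at h6
  rw [intervalIntegral.integral_eq_sub_of_hasDerivAt (fun t _ => hd t)
    (Continuous.intervalIntegrable (by fun_prop) _ _)]
  simp

theorem integral_kernel_right (z : ℂ) (s σ : ℝ) :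
    ∫ τ in s..σ, z * Complex.exp (z * (σ - τ)) = Complex.exp (z * (σ - s)) - 1 := by
  have hd : ∀ t : ℝ, HasDerivAt (fun t : ℝ => -Complex.exp (z * (σ - t)))
      (z * Complex.exp (z * (σ - t))) t := fun t => by
    have h5 : HasDerivAt (fun t : ℝ => z * ((σ : ℂ) - t)) (-z) t := by
      simpa using ((Complex.ofRealCLM.hasDerivAt (x := t)).const_sub (σ : ℂ)).const_mul z
    have h6 := h5.cexp.neg
    refine h6.congr_deriv ?_
    ring
  rw [intervalIntegral.integral_eq_sub_of_hasDerivAt (fun t _ => hd t)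
    (Continuous.intervalIntegrable (by fun_prop) _ _)]
  simp; ring

theorem intervalIntegrable_hist {F : Type*} [NormedAddCommGroup F] {f : ℝ → F} (hf : Integrable f histMeasure) {σ : ℝ}
    (hσ : σ ∈ Icc (-1 : ℝ) 0) : IntervalIntegrable f volume 0 σ := by
  rw [intervalIntegrable_iff, uIoc_of_ge hσ.2]
  exact IntegrableOn.mono_set hf fun s hs => ⟨hσ.1.trans hs.1.le, hs.2⟩

/-- The integrated form of $u'=zu+f$: integrating the kernel $ze^{z(\tau-s)}$ over $\tau$ first
gives $e^{z(\sigma-s)}-1$. Fubini stands in for differentiation, since $f$ is only integrable. -/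
theorem volterraFun_eq_integral_add [CompleteSpace X] {z : ℂ} {f : ℝ → X} (hf : Integrable f histMeasure) {σ : ℝ}
    (hσ : σ ∈ Icc (-1 : ℝ) 0) :
    volterraFun z f σ = z • (∫ τ in (0 : ℝ)..σ, volterraFun z f τ) + ∫ s in (0 : ℝ)..σ, f s := by
  have hi := intervalIntegrable_hist hf hσ
  have h1 := integral_integral_triangle
    (c := fun p : ℝ × ℝ => z * Complex.exp (z * (p.1 - p.2))) (by fun_prop) (h := f) hσ.2
    (by simpa [intervalIntegrable_iff, uIoc_of_ge hσ.2] using hi)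
  simp only [integral_kernel_left, sub_smul, one_smul, mul_smul,
    intervalIntegral.integral_smul] at h1
  rw [intervalIntegral.integral_sub (hi.continuousOn_smul (by fun_prop)) hi] at h1
  exact (eq_add_of_sub_eq h1.symm)

/-- The other composition, by Fubini with the kernel $ze^{z(\sigma-\tau)}$. It shows that the
Volterra operator also inverts from the left. -/
theorem volterraFun_sub_smul_primitive [CompleteSpace X] {z : ℂ} {f : ℝ → X} (hf : Integrable f histMeasure)
    {σ : ℝ} (hσ : σ ∈ Icc (-1 : ℝ) 0) :
    volterraFun z f σ - z • volterraFun z (fun τ => ∫ s in (0 : ℝ)..τ, f s) σ =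
      ∫ s in (0 : ℝ)..σ, f s := by
  have hi := intervalIntegrable_hist hf hσ
  have h1 := integral_integral_triangle
    (c := fun p : ℝ × ℝ => z * Complex.exp (z * (σ - p.1))) (by fun_prop) (h := f) hσ.2
    (by simpa [intervalIntegrable_iff, uIoc_of_ge hσ.2] using hi)
  simp only [integral_kernel_right, sub_smul, one_smul, mul_smul,
    intervalIntegral.integral_smul] at h1
  rw [intervalIntegral.integral_sub (hi.continuousOn_smul (by fun_prop)) hi] at h1
  rw [sub_eq_iff_eq_add', ← sub_eq_iff_eq_add]
  exact h1.symm

instance : IsProbabilityMeasure histMeasure :=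
  ⟨by rw [histMeasure, Measure.restrict_apply_univ, Real.volume_Icc]; norm_num⟩

theorem L2Hist.integral_norm_le {F : Type*} [NormedAddCommGroup F] (f : L2Hist F) : ∫ s, ‖f s‖ ∂histMeasure ≤ ‖f‖ := by
  rw [integral_norm_eq_lintegral_enorm (Lp.aestronglyMeasurable f), Lp.norm_def,
    ← eLpNorm_one_eq_lintegral_enorm]
  exact ENNReal.toReal_mono (Lp.eLpNorm_ne_top f)
    (eLpNorm_le_eLpNorm_of_exponent_le (by norm_num) (Lp.aestronglyMeasurable f))

theorem volterraFun_congr {z : ℂ} {f g : ℝ → X} (h : f =ᵐ[histMeasure] g) {σ : ℝ}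
    (hσ : σ ∈ Icc (-1 : ℝ) 0) : volterraFun z f σ = volterraFun z g σ :=
  intervalIntegral_congr_hist (h.mono fun s hs => by simp only [hs]) hσ

theorem norm_volterraFun_le (z : ℂ) (f : L2Hist X) {σ : ℝ} (hσ : σ ∈ Icc (-1 : ℝ) 0) :
    ‖volterraFun z f σ‖ ≤ Real.exp (max 0 (-z.re)) * ‖f‖ := by
  have hn : Integrable (fun s => Real.exp (max 0 (-z.re)) * ‖f s‖) histMeasure :=
    f.integrable.norm.const_mul _
  rw [volterraFun, intervalIntegral.integral_of_ge hσ.2, norm_neg]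
  have hsub : Ioc σ 0 ⊆ Icc (-1 : ℝ) 0 := fun s hs => ⟨hσ.1.trans hs.1.le, hs.2⟩
  calc _ ≤ ∫ s in Ioc σ 0, Real.exp (max 0 (-z.re)) * ‖f s‖ := by
        refine norm_integral_le_of_norm_le (IntegrableOn.mono_set hn hsub) ?_
        filter_upwards [ae_restrict_mem measurableSet_Ioc] with s hs
        rw [norm_smul, Complex.norm_exp]
        gcongr
        have e : (z * (σ - s)).re = (-z.re) * (s - σ) := by
          simp; ring
        rw [e]
        have h1 : 0 ≤ s - σ := by linarith [hs.1]
        have h2 : s - σ ≤ 1 := by linarith [hs.2, hσ.1]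
        calc _ ≤ max 0 (-z.re) * (s - σ) := by gcongr; exact le_max_right _ _
          _ ≤ max 0 (-z.re) * 1 := by gcongr
          _ = _ := mul_one _
    _ ≤ ∫ s in Icc (-1 : ℝ) 0, Real.exp (max 0 (-z.re)) * ‖f s‖ :=
        setIntegral_mono_set hn (Eventually.of_forall fun s => by positivity)
          hsub.eventuallyLE
    _ ≤ _ := by
        rw [integral_const_mul]
        gcongr
        exact f.integral_norm_le

theorem continuousOn_volterraFun (z : ℂ) {f : ℝ → X} (hf : Integrable f histMeasure) :
    ContinuousOn (volterraFun z f) (Icc (-1) 0) := by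
  have hi : IntervalIntegrable (fun s : ℝ => Complex.exp (-(z * s)) • f s) volume 0 (-1) :=
    (intervalIntegrable_hist hf ⟨le_rfl, by norm_num⟩).continuousOn_smul (by fun_prop)
  have := intervalIntegral.continuousOn_primitive_interval' hi left_mem_uIcc
  rw [uIcc_of_ge (by norm_num)] at this
  refine ContinuousOn.congr (ContinuousOn.smul (f := fun σ : ℝ => Complex.exp (z * σ)) ?_ this)
    fun σ _ => volterraFun_eq z f σ
  fun_prop

theorem memLp_volterraFun (z : ℂ) (f : L2Hist X) : MemLp (volterraFun z f) 2 histMeasure := by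
  refine MemLp.of_bound ((continuousOn_volterraFun z f.integrable).aestronglyMeasurable
    measurableSet_Icc) (Real.exp (max 0 (-z.re)) * ‖f‖) ?_
  filter_upwards [ae_restrict_mem measurableSet_Icc] with σ hσ
  exact norm_volterraFun_le z f hσ

/-- The bounded operator `f ↦ (σ ↦ ∫₀^σ e^{z(σ-s)} f(s) ds)` on `L²([-1,0], X)`. -/
def volterra (z : ℂ) : L2Hist X →L[ℂ] L2Hist X :=
  LinearMap.mkContinuous
    { toFun := fun f => (memLp_volterraFun z f).toLp _
      map_add' := fun f g => by
        rw [← MemLp.toLp_add]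
        refine MemLp.toLp_congr _ _ ?_
        filter_upwards [ae_restrict_mem measurableSet_Icc] with σ hσ
        rw [volterraFun_congr (Lp.coeFn_add f g) hσ, Pi.add_apply, volterraFun, volterraFun,
          volterraFun, ← intervalIntegral.integral_add
            ((f.intervalIntegrable hσ).continuousOn_smul (by fun_prop))
            ((g.intervalIntegrable hσ).continuousOn_smul (by fun_prop))]
        simp only [Pi.add_apply, smul_add]
      map_smul' := fun c f => by
        rw [RingHom.id_apply, ← MemLp.toLp_const_smul]
        refine MemLp.toLp_congr _ _ ?_
        filter_upwards [ae_restrict_mem measurableSet_Icc] with σ hσ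
        rw [volterraFun_congr (Lp.coeFn_smul c f) hσ, Pi.smul_apply, volterraFun, volterraFun,
          ← intervalIntegral.integral_smul]
        simp only [Pi.smul_apply, smul_comm c] }
    (Real.exp (max 0 (-z.re))) fun f => by
      refine (Lp.norm_le_of_ae_bound (C := Real.exp (max 0 (-z.re)) * ‖f‖) (by positivity)
        ?_).trans_eq ?_
      · filter_upwards [(memLp_volterraFun z f).coeFn_toLp, ae_restrict_mem measurableSet_Icc]
          with σ h1 hσ
        refine (congrArg norm h1).trans_le ?_
        exact norm_volterraFun_le z f hσ
      · simp [measureUnivNNReal]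

theorem norm_volterra_le (z : ℂ) : ‖(volterra z : L2Hist X →L[ℂ] L2Hist X)‖ ≤
    Real.exp (max 0 (-z.re)) :=
  LinearMap.mkContinuous_norm_le _ (Real.exp_nonneg _) _

theorem volterra_coeFn (z : ℂ) (f : L2Hist X) :
    volterra z f =ᵐ[histMeasure] volterraFun z f :=
  (memLp_volterraFun z f).coeFn_toLp

theorem isPrimitive_volterra [CompleteSpace X] (z : ℂ) (f : L2Hist X) :
    IsPrimitive 0 (volterra z f) (z • volterra z f + f) := by
  have h2 : (z • volterra z f + f : L2Hist X) =ᵐ[histMeasure]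
      fun σ => z • volterraFun z f σ + f σ := by
    filter_upwards [Lp.coeFn_add (z • volterra z f) f, Lp.coeFn_smul z (volterra z f),
      volterra_coeFn z f] with σ h1 h2 h3
    rw [h1, Pi.add_apply, h2, Pi.smul_apply, h3]
  filter_upwards [volterra_coeFn z f, ae_restrict_mem measurableSet_Icc] with σ h1 hσ
  rw [h1, intervalIntegral_congr_hist h2 hσ, intervalIntegral.integral_add
    ((intervalIntegrable_hist (f := fun s => z • volterraFun z f s)
      (((memLp_volterraFun z f).integrable (by norm_num)).smul z) hσ))
    (f.intervalIntegrable hσ), intervalIntegral.integral_smul, zero_add]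
  exact volterraFun_eq_integral_add f.integrable hσ

theorem volterra_deriv_sub_smul [CompleteSpace X] {z : ℂ} {f g : L2Hist X} (h : IsPrimitive 0 f g) :
    volterra z (g - z • f) = f := by
  rw [map_sub, map_smul]
  refine Lp.ext ?_
  have h' : f =ᵐ[histMeasure] fun τ => ∫ s in (0 : ℝ)..τ, g s := by
    filter_upwards [h] with τ hτ
    rw [hτ, zero_add]
  filter_upwards [Lp.coeFn_sub (volterra z g) (z • volterra z f), Lp.coeFn_smul z (volterra z f),
    volterra_coeFn z f, volterra_coeFn z g, h', ae_restrict_mem measurableSet_Icc]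
    with σ h1 h2 h3 h4 h5 hσ
  rw [h1, Pi.sub_apply, h2, Pi.smul_apply, h3, h4, h5, volterraFun_congr h' hσ]
  exact volterraFun_sub_smul_primitive g.integrable hσ

end Volterra

/-! ### The resolvent of $A_0$ and its relation to $\Phi_z$ -/

section ShiftResolvent

theorem IsResolventAt.unique {E : Type*} [NormedAddCommGroup E] [NormedSpace ℂ E]
    {A : E →ₗ.[ℂ] E} {z : ℂ} {R R' : E →L[ℂ] E} (h : IsResolventAt A z R)
    (h' : IsResolventAt A z R') : R = R' := by
  ext x
  obtain ⟨hx, hx'⟩ := h'.1 x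
  have := h.2 ⟨R' x, hx⟩
  rwa [hx'] at this

theorem IsResolventAt.opResolvent_eq {E : Type*} [NormedAddCommGroup E] [NormedSpace ℂ E]
    {A : E →ₗ.[ℂ] E} {z : ℂ} {R : E →L[ℂ] E} (h : IsResolventAt A z R) : opResolvent A z = R :=
  (opResolvent_spec ⟨R, h⟩).unique h

variable {X : Type*} [NormedAddCommGroup X] [NormedSpace ℂ X]

theorem norm_expL2_le {z : ℂ} (hz : 0 ≤ z.re) (x : X) : ‖expL2 z x‖ ≤ ‖x‖ := by
  refine (Lp.norm_le_of_ae_bound (norm_nonneg x) ?_).trans_eq (by simp [measureUnivNNReal])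
  filter_upwards [expL2_coeFn z x, ae_restrict_mem measurableSet_Icc] with σ h1 hσ
  rw [h1, norm_smul, Complex.norm_exp]
  refine mul_le_of_le_one_left (norm_nonneg _) (Real.exp_le_one_iff.2 ?_)
  have : (z * σ).re = z.re * σ := by simp
  rw [this]
  exact mul_nonpos_of_nonneg_of_nonpos hz hσ.2

variable [CompleteSpace X]

theorem W12.evalZero_eq {w : W12 X} {x : X} (h : IsPrimitive x w.1.fst w.1.snd) :
    W12.evalZero w = x :=
  ((Classical.choose_spec w.2).unique h).1

theorem W12.isPrimitive_evalZero (w : W12 X) :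
    IsPrimitive (W12.evalZero w) (W12.toL2 w) (W12.deriv w) :=
  Classical.choose_spec w.2

theorem shiftGenerator_apply_of_isPrimitive {f g : L2Hist X} (h : IsPrimitive 0 f g) :
    ∃ hf : f ∈ (shiftGenerator X).domain, shiftGenerator X ⟨f, hf⟩ = g := by
  let w : W12 X := ⟨WithLp.toLp 2 (f, g), 0, h⟩
  have hw : W12.evalZero w = 0 := W12.evalZero_eq h
  refine ⟨⟨w, hw, rfl⟩, ?_⟩
  have h1 : W12.ofL2 ⟨W12.toL2 w, ⟨w, rfl⟩⟩ = w := (LinearEquiv.symm_apply_eq _).2 rfl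
  exact congrArg W12.deriv h1

theorem isPrimitive_shiftGenerator (f : (shiftGenerator X).domain) :
    IsPrimitive 0 (f : L2Hist X) (shiftGenerator X f) := by
  obtain ⟨f, w, hw, rfl⟩ := f
  have hw0 : W12.evalZero w = 0 := hw
  have h1 := W12.isPrimitive_evalZero w
  rw [hw0] at h1
  have h2 := (shiftGenerator_apply_of_isPrimitive h1).2
  exact h2.symm ▸ h1

/-- The minus sign arises because $(z-A_0)u=f$ means $u'=zu-f$. Every $z$ is in the resolvent set,
so the default value in `shiftResolvent` never occurs. -/
theorem isResolventAt_shiftGenerator (z : ℂ) :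
    IsResolventAt (shiftGenerator X) z (-volterra z) := by
  refine ⟨fun f => ?_, fun y => ?_⟩
  · have h := (isPrimitive_volterra z f).smul (-1)
    simp only [smul_zero, neg_smul, one_smul] at h
    obtain ⟨h1, h2⟩ := shiftGenerator_apply_of_isPrimitive h
    refine ⟨h1, ?_⟩
    have h3 : shiftGenerator X ⟨(-volterra z : L2Hist X →L[ℂ] L2Hist X) f, h1⟩ =
      -(z • volterra z f + f) := h2
    rw [h3, neg_apply, smul_neg]
    abel
  · have h := volterra_deriv_sub_smul (z := z) (isPrimitive_shiftGenerator y)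
    rw [neg_apply, ← map_neg, neg_sub]
    exact h

theorem shiftResolvent_toL2 (z : ℂ) (f : L2Hist X) :
    W12.toL2 (shiftResolvent z f) = -volterra z f := by
  have hz : z ∈ opResolventSet (shiftGenerator X) := ⟨_, isResolventAt_shiftGenerator z⟩
  rw [shiftResolvent, dif_pos hz]
  change opResolvent (shiftGenerator X) z f = _
  rw [(isResolventAt_shiftGenerator z).opResolvent_eq]
  rfl

theorem shiftResolvent_deriv (z : ℂ) (f : L2Hist X) :
    W12.deriv (shiftResolvent z f) = z • W12.toL2 (shiftResolvent z f) - f := by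
  have hz : z ∈ opResolventSet (shiftGenerator X) := ⟨_, isResolventAt_shiftGenerator z⟩
  rw [shiftResolvent, dif_pos hz]
  rfl

theorem shiftResolvent_evalZero (z : ℂ) (f : L2Hist X) :
    W12.evalZero (shiftResolvent z f) = 0 := by
  have h := (isPrimitive_volterra z f).smul (-1)
  simp only [smul_zero, neg_smul, one_smul] at h
  refine W12.evalZero_eq ?_
  have e1 : (shiftResolvent z f).1.fst = -volterra z f := shiftResolvent_toL2 z f
  have e2 : (shiftResolvent z f).1.snd = -(z • volterra z f + f) := by
    refine (shiftResolvent_deriv z f).trans ?_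
    rw [shiftResolvent_toL2, smul_neg]
    abel
  rw [e1, e2]
  exact h

/-- The function $u=e^{z\cdot}x-x$ vanishes at $0$ and satisfies $(z-A_0)u=-zx$, with $x$ read as a
constant function. -/
theorem expW12_eq (z : ℂ) (x : X) :
    expW12 z x = expW12 0 x - z • shiftResolvent z (expL2 0 x) := by
  refine W12.toL2_injective ?_
  rw [map_sub, map_smul, shiftResolvent_toL2]
  change expL2 z x = expL2 0 x - z • -volterra z (expL2 0 x)
  have h := (expL2_isPrimitive z x).add ((expL2_isPrimitive 0 x).smul (-1))
  have e : x + (-1 : ℂ) • x = 0 := by simp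
  rw [e] at h
  have h1 := volterra_deriv_sub_smul (z := z) h
  have e2 : z • expL2 z x + (-1 : ℂ) • (0 : ℂ) • expL2 0 x - z • (expL2 z x + (-1 : ℂ) • expL2 0 x)
      = z • (expL2 0 x : L2Hist X) := by
    simp [smul_add]
  rw [e2, map_smul] at h1
  rw [smul_neg, h1]
  simp

/-- Transfers the analyticity and boundedness of $\Phi R(z,A_0)$ to holomorphy and linear growth of
$\Phi_z$. -/
theorem delaySymbol_eq (Φ : W12 X →L[ℂ] X) (z : ℂ) :
    delaySymbol Φ z = delaySymbol Φ 0 - z • ((Φ ∘L shiftResolvent z) ∘L expL2 0) := by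
  ext x
  change Φ (expW12 z x) = Φ (expW12 0 x) - z • Φ (shiftResolvent z (expL2 0 x))
  rw [expW12_eq z x, map_sub, map_smul]

end ShiftResolvent

/-! ### Generators, resolvent families and their holomorphy -/

section Generator

variable {E : Type*} [NormedAddCommGroup E] [NormedSpace ℂ E]

theorem hasGenerator_of_generator_eq {T : C0Semigroup E} {A : E →ₗ.[ℂ] E} (h : T.generator = A)
    {p : E} (hp : p ∈ A.domain) : T.HasGenerator p (A ⟨p, hp⟩) := by
  subst h
  exact Classical.choose_spec hp

theorem C0Semigroup.HasGenerator.generator_apply {T : C0Semigroup E} {A : E →ₗ.[ℂ] E}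
    (h : T.generator = A) {x y : E} (hxy : T.HasGenerator x y) :
    ∃ hx : x ∈ A.domain, A ⟨x, hx⟩ = y := by
  subst h
  exact ⟨⟨y, hxy⟩, (Classical.choose_spec (⟨y, hxy⟩ : ∃ y, T.HasGenerator x y)).unique hxy⟩

/-- `L` is, on the half-plane `Re z > w`, a resolvent of the generator of `T`, with the
Hille–Yosida bound of first order. -/
structure C0Semigroup.IsResolventFamily (T : C0Semigroup E) (M w : ℝ) (L : ℂ → E →L[ℂ] E) :
    Prop where
  norm_le : ∀ z : ℂ, w < z.re → ‖L z‖ ≤ M / (z.re - w)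
  hasGenerator : ∀ z : ℂ, w < z.re → ∀ x, T.HasGenerator (L z x) (z • L z x - x)
  apply_generator : ∀ z : ℂ, w < z.re → ∀ x y, T.HasGenerator x y → L z y = z • L z x - x

variable {T : C0Semigroup E} {M w : ℝ} {L : ℂ → E →L[ℂ] E}

theorem C0Semigroup.IsResolventFamily.isResolventAt (hL : T.IsResolventFamily M w L)
    {A : E →ₗ.[ℂ] E} (h : T.generator = A) {z : ℂ} (hz : w < z.re) :
    IsResolventAt A z (L z) := by
  refine ⟨fun x => ?_, fun y => ?_⟩
  · obtain ⟨h1, h2⟩ := (hL.hasGenerator z hz x).generator_apply h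
    exact ⟨h1, by rw [h2, sub_sub_cancel]⟩
  · rw [map_sub, map_smul, hL.apply_generator z hz _ _ (hasGenerator_of_generator_eq h y.2),
      sub_sub_cancel]

theorem C0Semigroup.IsResolventFamily.sub_eq (hL : T.IsResolventFamily M w L) {z u : ℂ}
    (hz : w < z.re) (hu : w < u.re) : L z - L u = (u - z) • (L z * L u) := by
  ext x
  have := resolvent_identity (hL.apply_generator z hz) (hL.hasGenerator u hu) x
  rw [sub_apply, this, add_sub_cancel_left]
  rfl

theorem C0Semigroup.IsResolventFamily.eventually_lt {u : ℂ} (hu : w < u.re) :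
    ∀ᶠ z : ℂ in 𝓝 u, w < z.re :=
  Complex.continuous_re.continuousAt.eventually_const_lt hu

/-- The resolvent identity, together with the local boundedness given by the Hille–Yosida estimate.
-/
theorem C0Semigroup.IsResolventFamily.continuousAt (hL : T.IsResolventFamily M w L) {u : ℂ}
    (hu : w < u.re) : ContinuousAt L u := by
  rw [ContinuousAt, tendsto_iff_norm_sub_tendsto_zero]
  have h1 : ContinuousAt (fun z : ℂ => ‖u - z‖ * (M / (z.re - w) * ‖L u‖)) u := by
    have h2 : ContinuousAt (fun z : ℂ => M / (z.re - w)) u :=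
      ContinuousAt.div (by fun_prop) (by fun_prop) (sub_pos.2 hu).ne'
    fun_prop
  have h3 := h1.tendsto
  simp only [sub_self, norm_zero, zero_mul] at h3
  refine squeeze_zero' (Eventually.of_forall fun z => norm_nonneg _) ?_ h3
  filter_upwards [eventually_lt hu] with z hz
  rw [hL.sub_eq hz hu, norm_smul]
  gcongr
  exact (norm_mul_le _ _).trans (by gcongr; exact hL.norm_le z hz)

theorem C0Semigroup.IsResolventFamily.differentiableAt (hL : T.IsResolventFamily M w L) {u : ℂ}
    (hu : w < u.re) : DifferentiableAt ℂ L u := by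
  have h : HasDerivAt L (-(L u * L u)) u := by
    rw [hasDerivAt_iff_tendsto_slope]
    have h1 : Tendsto (fun z => -(L z * L u)) (𝓝[≠] u) (𝓝 (-(L u * L u))) :=
      (((hL.continuousAt hu).tendsto.mul_const (L u)).neg).mono_left nhdsWithin_le_nhds
    refine h1.congr' ?_
    filter_upwards [self_mem_nhdsWithin, nhdsWithin_le_nhds (eventually_lt hu)] with z hzu hz
    have hne : z - u ≠ 0 := sub_ne_zero.2 hzu
    rw [slope_def_module, hL.sub_eq hz hu, smul_smul, ← neg_sub z u, mul_neg,
      inv_mul_cancel₀ hne, neg_one_smul]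
  exact h.differentiableAt

end Generator

theorem norm_toLp_prod_le {E F : Type*} [NormedAddCommGroup E] [NormedAddCommGroup F] (x : E)
    (y : F) : ‖(WithLp.toLp 2 (x, y) : WithLp 2 (E × F))‖ ≤ ‖x‖ + ‖y‖ := by
  rw [WithLp.prod_norm_eq_of_L2]
  refine Real.sqrt_le_iff.2 ⟨by positivity, ?_⟩
  simp only [WithLp.toLp_fst, WithLp.toLp_snd]
  nlinarith [norm_nonneg x, norm_nonneg y]

theorem norm_volterra_apply_le {X : Type*} [NormedAddCommGroup X] [NormedSpace ℂ X] {z : ℂ}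
    (hz : 0 ≤ z.re) (f : L2Hist X) : ‖volterra z f‖ ≤ ‖f‖ := by
  have h := ContinuousLinearMap.le_of_opNorm_le (volterra z : L2Hist X →L[ℂ] L2Hist X)
    (norm_volterra_le z) f
  rwa [max_eq_left (by linarith), Real.exp_zero, one_mul] at h

/-! ### Extension to the half-plane and the resolvent equation of $\mathcal A$ -/

section DelaySymbol

variable {X : Type*} [NormedAddCommGroup X] [NormedSpace ℂ X] [CompleteSpace X]
  {Φ : W12 X →L[ℂ] X}

theorem Admissible.differentiable_delaySymbol (hΦ : Admissible Φ) :
    Differentiable ℂ (delaySymbol Φ) := by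
  intro z
  have h1 : DifferentiableAt ℂ (fun z : ℂ => Φ ∘L shiftResolvent z) z :=
    ((hΦ.2 (z.re - 1)).1 z (by simp)).differentiableAt
  have e : delaySymbol Φ = fun z => delaySymbol Φ 0 -
      z • ((Φ ∘L shiftResolvent z) ∘L expL2 0) := funext fun z => delaySymbol_eq Φ z
  rw [e]
  exact (differentiableAt_const _).sub
    (differentiableAt_id.smul (h1.clm_comp (differentiableAt_const _)))

theorem Admissible.exists_norm_delaySymbol_le (hΦ : Admissible Φ) :
    ∃ D : ℝ, 0 ≤ D ∧ ∀ z : ℂ, 0 ≤ z.re → ‖delaySymbol Φ z‖ ≤ D * (1 + ‖z‖) := by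
  obtain ⟨C, hC⟩ := (hΦ.2 (-1)).2
  set e : X →L[ℂ] L2Hist X := expL2 0
  have hC0 : 0 ≤ C := (norm_nonneg _).trans (hC 0 (by simp))
  refine ⟨‖delaySymbol Φ 0‖ + C * ‖e‖, by positivity, fun z hz => ?_⟩
  rw [delaySymbol_eq]
  calc _ ≤ ‖delaySymbol Φ 0‖ + ‖z‖ * (C * ‖e‖) := by
        refine (norm_sub_le _ _).trans ?_
        rw [norm_smul]
        gcongr
        refine (ContinuousLinearMap.opNorm_comp_le _ _).trans ?_
        gcongr
        exact hC z (by linarith)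
    _ ≤ _ := by
        have := norm_nonneg z
        have : 0 ≤ C * ‖e‖ := by positivity
        nlinarith [norm_nonneg (delaySymbol Φ 0)]

/-- Bounds of the powers of `Φ_z R(z, B)` on the imaginary axis extend to the right
half-plane. -/
theorem Admissible.norm_pow_le_of_imaginary_axis (hΦ : Admissible Φ) {S : C0Semigroup X}
    {M w : ℝ} (hw : w < 0) {L : ℂ → X →L[ℂ] X} (hL : S.IsResolventFamily M w L) {n : ℕ} {C : ℝ}
    (hC : ∀ ω : ℝ, ‖(delaySymbol Φ (ω * Complex.I) * L (ω * Complex.I)) ^ n‖ ≤ C)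
    {z : ℂ} (hz : 0 ≤ z.re) : ‖(delaySymbol Φ z * L z) ^ n‖ ≤ C := by
  rcases Nat.eq_zero_or_pos n with rfl | hn
  · simpa using hC 0
  obtain ⟨D, hD0, hD⟩ := hΦ.exists_norm_delaySymbol_le
  have hM : 0 ≤ M := by
    have := (norm_nonneg _).trans (hL.norm_le 0 (by simpa using hw))
    rw [Complex.zero_re, zero_sub] at this
    have h := mul_nonneg this (neg_pos.2 hw).le
    rwa [div_mul_cancel₀ _ (neg_pos.2 hw).ne'] at h
  have hP : ∀ u : ℂ, 0 ≤ u.re → ‖delaySymbol Φ u * L u‖ ≤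
      D * (1 + ‖u‖) * (M / (u.re - w)) := fun u hu =>
    (norm_mul_le _ _).trans (mul_le_mul (hD u hu) (hL.norm_le u (by linarith)) (norm_nonneg _)
      (by positivity))
  -- The powers have order $1<2$ with exponential rate $n$, and are bounded along the positive real
  -- axis, so the imaginary-axis bound holds throughout with the same $C$.
  refine PhragmenLindelof.right_half_plane_of_bounded_on_real
    (f := fun u => (delaySymbol Φ u * L u) ^ n) ?_ ⟨1, one_lt_two, n, ?_⟩ ?_ hC hz
  · refine DifferentiableOn.diffContOnCl fun u hu => ?_
    rw [Complex.closure_setOfPred_lt_re] at hu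
    have hu' : w < u.re := lt_of_lt_of_le hw hu
    exact (((hΦ.differentiable_delaySymbol u).mul (hL.differentiableAt hu')).pow
      n).differentiableWithinAt
  · refine Asymptotics.IsBigO.of_bound ((D * (M / -w)) ^ n) ?_
    refine eventually_inf_principal.2 (Eventually.of_forall fun u hu => ?_)
    have hu0 : 0 ≤ u.re := le_of_lt hu
    have hw' : 0 < -w := by linarith
    calc ‖(delaySymbol Φ u * L u) ^ n‖ ≤ ‖delaySymbol Φ u * L u‖ ^ n := norm_pow_le' _ hn
      _ ≤ (D * Real.exp ‖u‖ * (M / -w)) ^ n := by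
          gcongr
          refine (hP u hu0).trans ?_
          have h1 := Real.add_one_le_exp ‖u‖
          have h2 : 0 ≤ M / (u.re - w) := div_nonneg hM (by linarith)
          gcongr
          · linarith
          · linarith
      _ = (D * (M / -w)) ^ n * Real.exp ‖u‖ ^ n := by ring
      _ = _ := by
          rw [Real.rpow_one, Real.norm_of_nonneg (Real.exp_nonneg _), ← Real.exp_nat_mul]
  -- On the real axis linear growth meets decay: $(1+x)/(x-w)\le 1+1/(-w)$ for $x>0$, because $w<0$.
  · refine ⟨(D * (M * (1 + 1 / -w))) ^ n, ?_⟩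
    rw [eventually_map]
    filter_upwards [eventually_gt_atTop 0] with x hx
    refine (norm_pow_le' _ hn).trans ?_
    gcongr
    refine (hP x (by simpa using hx.le)).trans ?_
    rw [Complex.norm_real, Real.norm_of_nonneg hx.le, Complex.ofReal_re, mul_assoc]
    have hxw : 0 < x - w := by linarith
    refine mul_le_mul_of_nonneg_left ?_ hD0
    rw [mul_div_assoc', div_le_iff₀ hxw]
    have hw' : 0 < -w := by linarith
    have h1 : 1 + x ≤ (1 + 1 / -w) * (x - w) := by
      have h2 : (1 + 1 / -w) * (x - w) = x - w + x * (1 / -w) + 1 := by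
        have : w ≠ 0 := hw.ne
        field_simp
        ring
      have : 0 ≤ x * (1 / -w) := by positivity
      rw [h2]; linarith
    calc (1 + x) * M ≤ (1 + 1 / -w) * (x - w) * M := by gcongr
      _ = _ := by ring

/-- The resolvent equation of the delay operator, solved by a Neumann series. -/
theorem exists_delay_resolvent {B : X →ₗ.[ℂ] X} {S : C0Semigroup X} (hB : S.generator = B)
    {T : C0Semigroup (StateSpace X)} (hT : T.generator = delayOperator B Φ)
    {z : ℂ} (hz : 0 ≤ z.re) {R : X →L[ℂ] X} (hR : ∀ x, S.HasGenerator (R x) (z • R x - x))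
    {a : ℕ → ℝ} (ha : Summable a) (hP : ∀ n, ‖(delaySymbol Φ z * R) ^ n‖ ≤ a n)
    {C r : ℝ} (hr : ‖R‖ ≤ r) (hC : ‖Φ ∘L shiftResolvent z‖ ≤ C) (p : StateSpace X) :
    ∃ q, T.HasGenerator q (z • q - p) ∧
      ‖q‖ ≤ (2 * (r * (∑' n, a n) * (1 + C)) + 1) * ‖p‖ := by
  set P := delaySymbol Φ z * R
  have hs : Summable (P ^ ·) := Summable.of_norm_bounded ha hP
  set N := ∑' n, P ^ n
  have hN : ‖N‖ ≤ ∑' n, a n := tsum_of_norm_bounded ha.hasSum hP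
  have hN1 : N - P * N = 1 := by
    have := hs.one_sub_mul_tsum_pow
    rwa [sub_mul, one_mul] at this
  -- Here $x'$ is the right-hand side of $(z-B-\Phi_z)y=x'$, obtained by eliminating the history
  -- coordinate; $N=(1-\Phi_zR)^{-1}$ gives $y=RNx'$, and $W$ is the history with $W(0)=y$.
  set x' := p.fst + Φ (shiftResolvent z p.snd)
  set y := R (N x')
  set W : W12 X := expW12 z y + shiftResolvent z p.snd
  have hW0 : W12.evalZero W = y := by
    rw [map_add, shiftResolvent_evalZero, add_zero]
    exact W12.evalZero_eq (expL2_isPrimitive z y)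
  have hW2 : W12.toL2 W = expL2 z y - volterra z p.snd := by
    rw [map_add, shiftResolvent_toL2, sub_eq_add_neg]
    rfl
  have hW3 : W12.deriv W = z • W12.toL2 W - p.snd := by
    have e : W12.deriv (expW12 z y) = z • W12.toL2 (expW12 z y) := rfl
    rw [map_add, shiftResolvent_deriv, map_add, smul_add, e]
    abel
  have hΦW : Φ W = delaySymbol Φ z y + Φ (shiftResolvent z p.snd) := map_add Φ _ _
  obtain ⟨hy, hBy⟩ := (hR (N x')).generator_apply hB
  have hyW : W12.evalZero W ∈ B.domain := by rw [hW0]; exact hy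
  have hBW : B ⟨W12.evalZero W, hyW⟩ = z • y - N x' := by
    rw [← hBy]
    congr 1
    exact Subtype.ext hW0
  refine ⟨WithLp.toLp 2 (W12.evalZero W, W12.toL2 W), ?_, ?_⟩
  · have h := hasGenerator_of_generator_eq hT
      (p := WithLp.toLp 2 (W12.evalZero W, W12.toL2 W)) ⟨hyW, W, rfl, rfl⟩
    rw [delayOperator_apply B Φ W hyW, hBW, hΦW, hW3] at h
    have hNx : N x' - delaySymbol Φ z y = x' := congrArg (fun A : X →L[ℂ] X => A x') hN1
    have e1 : z • y - N x' + (delaySymbol Φ z y + Φ (shiftResolvent z p.snd)) =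
        z • W12.evalZero W - p.fst := by
      have e2 : p.fst = x' - Φ (shiftResolvent z p.snd) := (add_sub_cancel_right _ _).symm
      rw [e2, hW0, ← sub_eq_zero]
      rw [← sub_eq_zero] at hNx
      rw [← neg_eq_zero, ← hNx]
      abel
    rw [e1] at h
    exact h
  · have hr0 : 0 ≤ r := (norm_nonneg _).trans hr
    have hC0 : 0 ≤ C := (norm_nonneg _).trans hC
    have hN0 : 0 ≤ ∑' n, a n := (norm_nonneg _).trans hN
    have hp1 : ‖p.fst‖ ≤ ‖p‖ := WithLp.norm_fst_le (x := p)
    have hp2 : ‖p.snd‖ ≤ ‖p‖ := WithLp.norm_snd_le (x := p)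
    have hx' : ‖x'‖ ≤ (1 + C) * ‖p‖ := by
      have h1 : ‖Φ (shiftResolvent z p.snd)‖ ≤ C * ‖p.snd‖ :=
        (Φ ∘L shiftResolvent z).le_of_opNorm_le hC p.snd
      calc ‖x'‖ ≤ ‖p.fst‖ + C * ‖p.snd‖ := (norm_add_le _ _).trans (by gcongr)
        _ ≤ ‖p‖ + C * ‖p‖ := by gcongr
        _ = _ := by ring
    have hyn : ‖y‖ ≤ r * (∑' n, a n) * (1 + C) * ‖p‖ := by
      calc ‖y‖ ≤ r * ‖N x'‖ := R.le_of_opNorm_le hr _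
        _ ≤ r * ((∑' n, a n) * ‖x'‖) := by gcongr; exact N.le_of_opNorm_le hN _
        _ ≤ r * ((∑' n, a n) * ((1 + C) * ‖p‖)) := by gcongr
        _ = _ := by ring
    -- For $\operatorname{Re}z\ge0$ both $e^{z\cdot}$ and the Volterra operator are contractive.
    -- Thus $\|q\|\le2\|y\|+\|p\|$, which explains the shape of the constant.
    have hg : ‖W12.toL2 W‖ ≤ ‖y‖ + ‖p‖ := by
      rw [hW2]
      exact (norm_sub_le _ _).trans (add_le_add (norm_expL2_le hz y)
        ((norm_volterra_apply_le hz _).trans hp2))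
    have hq : ‖(WithLp.toLp 2 (W12.evalZero W, W12.toL2 W) : StateSpace X)‖ ≤
        ‖W12.evalZero W‖ + ‖W12.toL2 W‖ := norm_toLp_prod_le _ _
    refine hq.trans ?_
    rw [hW0]
    linarith

end DelaySymbol

end DelayEq

end

/-! ### The stability theorem -/

open DelayEq
theorem mainTheorem3 {X : Type*} [NormedAddCommGroup X] [InnerProductSpace ℂ X] [CompleteSpace X]
    (Φ : W12 X →L[ℂ] X) (hΦ : Admissible Φ)
    (B : X →ₗ.[ℂ] X) (S : C0Semigroup X) (hB : S.generator = B) (hS : S.growthBound < 0)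
    (hsum : ∑' n : ℕ, ⨆ ω : ℝ,
      ‖(delaySymbol Φ (ω * Complex.I) * opResolvent B (ω * Complex.I)) ^ n‖ₑ < ⊤) :
    ∃ T : C0Semigroup (StateSpace X),
      T.generator = delayOperator B Φ ∧ T.growthBound < 0 := by
  obtain ⟨T, hT⟩ := hΦ.1 B ⟨S, hB⟩
  refine ⟨T, hT, ?_⟩
  obtain ⟨w, hw0, M, hM⟩ := S.growthBound_lt_iff.1 hS
  have hw : w < 0 := by exact_mod_cast hw0
  obtain ⟨L, hL'⟩ := C0Semigroup.exists_laplace hM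
  have hL : S.IsResolventFamily M w L :=
    ⟨fun z hz => (hL' z hz).2.1, fun z hz => (hL' z hz).2.2.1, fun z hz => (hL' z hz).2.2.2⟩
  set a : ℕ → ℝ≥0∞ := fun n => ⨆ ω : ℝ,
      ‖(delaySymbol Φ (ω * Complex.I) * opResolvent B (ω * Complex.I)) ^ n‖ₑ with ha
  -- Finiteness of the sum in $[0,\infty]$ contains both the finiteness of each $a_n$ and
  -- summability.
  have hsummable : Summable fun n => (a n).toReal := ENNReal.summable_toReal hsum.ne
  have hP : ∀ z : ℂ, 0 ≤ z.re → ∀ n, ‖(delaySymbol Φ z * L z) ^ n‖ ≤ (a n).toReal := by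
    intro z hz n
    refine hΦ.norm_pow_le_of_imaginary_axis hw hL (fun ω => ?_) hz
    have hre : w < ((ω : ℂ) * Complex.I).re := by simpa using hw
    rw [← (hL.isResolventAt hB hre).opResolvent_eq, ← toReal_enorm]
    exact ENNReal.toReal_mono (ENNReal.ne_top_of_tsum_ne_top hsum.ne n)
      (le_iSup (fun ω : ℝ =>
        ‖(delaySymbol Φ (ω * Complex.I) * opResolvent B (ω * Complex.I)) ^ n‖ₑ) ω)
  obtain ⟨C, hC⟩ := (hΦ.2 0).2
  have hM0 : 0 ≤ M := by simpa using (norm_nonneg _).trans (hM 0)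
  have hC0 : 0 ≤ C := (norm_nonneg (Φ ∘L shiftResolvent 1)).trans (hC 1 (by simp))
  have hw' : 0 < -w := by linarith
  -- The bound $M/(\operatorname{Re}z-w)\le M/(-w)$ makes $K$ independent of $z$.
  refine T.growthBound_neg_of_resolvent_bounded
    (K := 2 * (M / -w * (∑' n, (a n).toReal) * (1 + C)) + 1) ?_ fun z hz p => ?_
  · have : 0 ≤ ∑' n, (a n).toReal := tsum_nonneg fun n => ENNReal.toReal_nonneg
    positivity
  · refine exists_delay_resolvent hB hT hz.le (hL.hasGenerator z (hw.trans hz)) hsummable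
      (hP z hz.le) ((hL.norm_le z (hw.trans hz)).trans ?_) (hC z hz) p
    gcongr
    linarith
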